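/- Let $q\in C^\infty[0,\infty)$ be a real potential with $\operatorname{supp}q\subset[0,a]$, $0\le a<\infty$. For a control $f\in C^\infty[0,\infty)$ vanishing near $\tau=0$ consider the scattering problem $$u_{tt}-u_{xx}+qu=0\quad (x>0,\ -\infty<t<x),\qquad u|_{t<-x}=0,\qquad \lim_{s\to\infty}u(s,\tau-s)=f(\tau)\quad(\tau\ge 0).$$ There is a fundamental solution $u^\delta(x,t)=\delta(x+t)+w(x,t)$ of this problem (for $f=\delta$), where $w$ is continuous in $\{-x\le t\le x\}$, $w|_{t<-x}=0$, $\lim_{s\to\infty}w(s,\tau-s)=0$ for $\tau\ge0$, and the wave equation holds in the sense of distributions, such that, with $f$ extended by zero to the negative semi-axis, $$u^f(x,t)=(u^\delta * f)(x,t)=f(x+t)+\int_0^{x+t}w(x,t-s)f(s)\,ds\quad (x+t\ge0),\qquad u^f(x,t)=0\quad (x+t<0),$$ is the unique smooth classical solution of the problem for every such $f$; for $f\in L_2(0,\infty)$ this formula defines the generalized solution $u^f$. Moreover, there is $r\in C^\infty[0,\infty)$ with $\operatorname{supp}r\subset[0,2a]$ such that $u^\delta(x,t)=\delta(x+t)+r(x-t)$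 for $x>a$, $-x\le t\le x$. The control operator $(Wf)(x)=u^f(x,0)$ is bounded in the real space $L_2(0,\infty)$, and there is a bounded response operator $R$ in $L_2(0,\infty)$ with $(Rf)(\tau)=\lim_{s\to+\infty}u^f(s,s-\tau)$ for a.e. $\tau>0$ whenever $f\in L_2(0,\infty)$ vanishes at infinity. For all $f\in L_2(0,\infty)$, $$(Rf)(\tau)=\int_0^\infty r(\tau+s)f(s)\,ds\qquad\text{for a.e. }\tau>0,$$ and the connecting operator $C:=W^*W$ satisfies $$C=\mathbb I+R,$$ where $\mathbb I$ is the identity operator in $L_2(0,\infty)$. -/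

import Mathlib

open Set Filter Topology MeasureTheory
open scoped ContDiff

noncomputable section

namespace Scattering

/-- The space-time domain `x > 0`, `-∞ < t < x` of the scattering problem (points are `(x, t)`). -/
def domain : Set (ℝ × ℝ) := {p | 0 < p.1 ∧ p.2 < p.1}

/-- The closed cone `-x ≤ t ≤ x`. -/
def cone : Set (ℝ × ℝ) := {p | -p.1 ≤ p.2 ∧ p.2 ≤ p.1}

/-- The wave operator `u ↦ u_tt - u_xx + q u`, evaluated at `(x, t)`. -/
def waveOp (q : ℝ → ℝ) (u : ℝ → ℝ → ℝ) (x t : ℝ) : ℝ :=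
  iteratedDeriv 2 (fun s => u x s) t - iteratedDeriv 2 (fun y => u y t) x + q x * u x t

/-- Smooth controls: `f ∈ C^∞[0,∞)`, vanishing near `τ = 0`.
(Only the values of `f` on `[0,∞)` matter.) -/
structure IsSmoothControl (f : ℝ → ℝ) : Prop where
  smooth : ContDiffOn ℝ ∞ f (Ici 0)
  vanish : ∃ ε > 0, ∀ τ, 0 ≤ τ → τ ≤ ε → f τ = 0

/-- `u` is a classical (smooth) solution of the scattering problem with control `f`:
the wave equation holds for `x > 0`, `t < x`, the wave vanishes for `t < -x`, and
`f` is the wave coming in from `x = ∞`. -/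
structure IsClassicalSolution (q f : ℝ → ℝ) (u : ℝ → ℝ → ℝ) : Prop where
  smooth : ContDiffOn ℝ ∞ (fun p : ℝ × ℝ => u p.1 p.2) domain
  equation : ∀ x t, 0 < x → t < x → waveOp q u x t = 0
  causal : ∀ x t, 0 < x → t < -x → u x t = 0
  incoming : ∀ τ, 0 ≤ τ → Tendsto (fun s => u s (τ - s)) atTop (𝓝 (f τ))

/-- `δ(x + t) + w(x, t)` is a fundamental solution of the scattering problem, i.e. the solution
for the control `f = δ`. Its regular part `w` is continuous in the closed cone, vanishes for
`t < -x`, and brings no contribution from `x = ∞`; the wave equation is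
understood in the sense of distributions on `domain`, the distribution `δ(x + t)` being
`ψ ↦ ∫ ψ(x, -x) dx`. -/
structure IsFundamentalSolution (q : ℝ → ℝ) (w : ℝ → ℝ → ℝ) : Prop where
  continuousOn : ContinuousOn (fun p : ℝ × ℝ => w p.1 p.2) cone
  causal : ∀ x t, 0 < x → t < -x → w x t = 0
  equation : ∀ φ : ℝ → ℝ → ℝ, ContDiff ℝ ∞ (fun p : ℝ × ℝ => φ p.1 p.2) →
    HasCompactSupport (fun p : ℝ × ℝ => φ p.1 p.2) →
    tsupport (fun p : ℝ × ℝ => φ p.1 p.2) ⊆ domain →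
    (∫ x in Ioi (0 : ℝ), waveOp q φ x (-x)) +
      ∫ p in domain, w p.1 p.2 * waveOp q φ p.1 p.2 = 0
  incoming : ∀ τ, 0 ≤ τ → Tendsto (fun s => w s (τ - s)) atTop (𝓝 0)

/-- The Duhamel representation `u^f = u^δ * f` (convolution in time) of the wave produced by the
control `f`, where `u^δ = δ(x + t) + w` and `f` is extended by zero to the negative semi-axis. -/
def wave (w : ℝ → ℝ → ℝ) (f : ℝ → ℝ) (x t : ℝ) : ℝ :=
  if 0 ≤ x + t then f (x + t) + ∫ s in (0 : ℝ)..(x + t), w x (t - s) * f s else 0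

/-- Lebesgue measure on the semi-axis `(0,∞)`. -/
abbrev halfLine : Measure ℝ := volume.restrict (Ioi 0)

/-- The real Hilbert space `L₂(0,∞)`: both the outer space (of controls) and the inner space
(of states). -/
abbrev L2 : Type := Lp ℝ 2 halfLine

/-- `W` is the control operator `(W f)(x) = u^f(x, 0)`. -/
def IsControlOperator (w : ℝ → ℝ → ℝ) (W : L2 →L[ℝ] L2) : Prop :=
  ∀ (f : ℝ → ℝ) (hf : MemLp f 2 halfLine), W (hf.toLp f) =ᵐ[halfLine] fun x => wave w f x 0

/-- The connecting operator `C = W* W`. -/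
def connectingOperator (W : L2 →L[ℝ] L2) : L2 →L[ℝ] L2 :=
  (ContinuousLinearMap.adjoint W).comp W

/-- `R` is the response operator: the bounded operator in `L₂(0,∞)` with
`(R f)(τ) = lim_{s → ∞} u^f(s, s - τ)` for the controls `f` that vanish at infinity
(these are dense; for the other controls the pointwise limit need not exist). -/
def IsResponseOperator (w : ℝ → ℝ → ℝ) (R : L2 →L[ℝ] L2) : Prop :=
  ∀ (f : ℝ → ℝ) (hf : MemLp f 2 halfLine), Tendsto f atTop (𝓝 0) →
    ∀ᵐ τ ∂halfLine, Tendsto (fun s => wave w f s (s - τ)) atTop (𝓝 (R (hf.toLp f) τ))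

/-- `r ∈ C^∞[0,∞)`, `supp r ⊆ [0, 2a]`, is the reflection kernel of the fundamental solution:
`u^δ(x, t) = δ(x + t) + r(x - t)` for `x > a`. -/
structure IsReflectionKernel (a : ℝ) (w : ℝ → ℝ → ℝ) (r : ℝ → ℝ) : Prop where
  smooth : ContDiffOn ℝ ∞ r (Ici 0)
  support : ∀ τ, 2 * a < τ → r τ = 0
  reflected : ∀ x t, a < x → -x ≤ t → t ≤ x → w x t = r (x - t)

end Scattering

end

/-! In the characteristic coordinates ξ = x + t, η = x − t the wave operator is −4 ∂_ξ∂_η + q. With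
Q(s) = q(s/2)/4, the regular part v of the fundamental solution therefore solves v_ξη = Q(ξ + η) v.
The singular term δ on ξ = 0 forces v_η(0, η) = Q(η), and the absence of an incoming regular wave
forces v = 0 for ξ ≥ 0, η ≥ M = 2a. Integrating twice gives the Volterra equation of
`IsGoursatKernel`, solved by Picard iteration in `exists_isGoursatKernel`. In the quadrant ξ, η ≥ 0,
once ξ + η ≥ M the potential is no longer felt and v depends on η alone
(`IsGoursatKernel.eq_reflected`), whence r(τ) = v(M, τ).

The distributional equation is Green's identity on a square (`IsGoursatKernel.green`). Uniqueness
holds because the difference of two solutions satisfies the homogeneous Volterra equation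
(`IsClassicalSolution.eq_zero`). Smoothness is obtained order by order: the kernel on the quadrant
depends only on Q on [0, ∞) (`IsGoursatKernel.eq_of_eqOn`), so C^n extensions of q, one for each n,
suffice.

The control operator is W = 1 + K, where K has kernel k(x, s) = v(x − s, x + s) on 0 ≤ s ≤ x.
Expanding W*W reduces C = 1 + R to k(x, s) + ∫ k(y, x) k(y, s) dy = v(M, x + s) for s < x. With α =
x + s, β = x − s this is `IsGoursatKernel.quadratic_identity`. Its left side P(α, β) satisfies
∂_β∂_α P = 0: the two factors under the integral meet Q at the same point, so the differentiated
integrand is an exact y-derivative whose boundary term cancels Q(α + β) v(β, α). Since P = v(M, α)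
for α + β ≥ M, this persists for all α, β ≥ 0. -/

namespace Scattering

/-! ### Parameter-dependent integrals and regularity from partial derivatives -/

section ParametricIntegral

variable {E G : Type} [NormedAddCommGroup E] [NormedSpace ℝ E] [FiniteDimensional ℝ E]
  [NormedAddCommGroup G] [NormedSpace ℝ G]

/-- Differentiation under an integral over a compact interval. -/
theorem hasFDerivAt_intervalIntegral_param [CompleteSpace G] {F : E → ℝ → G}
    {F' : E → ℝ → E →L[ℝ] G}
    (hF : Continuous (Function.uncurry F)) (hF' : Continuous (Function.uncurry F'))
    (h : ∀ x t, HasFDerivAt (fun x => F x t) (F' x t) x) (a b : ℝ) (x₀ : E) :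
    HasFDerivAt (fun x => ∫ t in a..b, F x t) (∫ t in a..b, F' x₀ t) x₀ := by
  have hK : IsCompact (Metric.closedBall x₀ 1 ×ˢ uIcc a b) :=
    (isCompact_closedBall x₀ 1).prod isCompact_uIcc
  obtain ⟨C, hC⟩ := hK.exists_bound_of_continuousOn hF'.continuousOn
  refine intervalIntegral.hasFDerivAt_integral_of_dominated_of_fderiv_le
    (s := Metric.closedBall x₀ 1) (bound := fun _ => C) (Metric.closedBall_mem_nhds x₀ one_pos)
    (.of_forall fun x => ?_) ?_ ?_ (.of_forall fun t ht x hx => ?_) ?_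
    (.of_forall fun t _ x _ => h x t)
  · exact (hF.comp (Continuous.prodMk_right x)).aestronglyMeasurable
  · exact (hF.comp (Continuous.prodMk_right x₀)).intervalIntegrable _ _
  · exact (hF'.comp (Continuous.prodMk_right x₀)).aestronglyMeasurable
  · exact hC (x, t) ⟨hx, uIoc_subset_uIcc ht⟩
  · exact continuous_const.intervalIntegrable _ _

theorem hasDerivAt_intervalIntegral_param {F F' : ℝ → ℝ → ℝ}
    (hF : Continuous (Function.uncurry F)) (hF' : Continuous (Function.uncurry F'))
    (h : ∀ x t, HasDerivAt (fun x => F x t) (F' x t) x) (a b x₀ : ℝ) :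
    HasDerivAt (fun x => ∫ t in a..b, F x t) (∫ t in a..b, F' x₀ t) x₀ := by
  have hK : IsCompact (Metric.closedBall x₀ 1 ×ˢ uIcc a b) :=
    (isCompact_closedBall x₀ 1).prod isCompact_uIcc
  obtain ⟨C, hC⟩ := hK.exists_bound_of_continuousOn hF'.continuousOn
  refine (intervalIntegral.hasDerivAt_integral_of_dominated_loc_of_deriv_le
    (s := Metric.closedBall x₀ 1) (bound := fun _ => C) (Metric.closedBall_mem_nhds x₀ one_pos)
    (.of_forall fun x => ?_) ?_ ?_ (.of_forall fun t ht x hx => ?_) ?_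
    (.of_forall fun t _ x _ => h x t)).2
  · exact (hF.comp (Continuous.prodMk_right x)).aestronglyMeasurable
  · exact (hF.comp (Continuous.prodMk_right x₀)).intervalIntegrable _ _
  · exact (hF'.comp (Continuous.prodMk_right x₀)).aestronglyMeasurable
  · exact hC (x, t) ⟨hx, uIoc_subset_uIcc ht⟩
  · exact continuous_const.intervalIntegrable _ _

/-- The induction runs over all target spaces at once, because the derivative of the integral is an
integral with values in continuous linear maps. -/
theorem contDiff_intervalIntegral_param (n : ℕ) :
    ∀ {G : Type} [NormedAddCommGroup G] [NormedSpace ℝ G] [CompleteSpace G] {F : E → ℝ → G},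
    ContDiff ℝ n (Function.uncurry F) → ∀ a b : ℝ, ContDiff ℝ n fun x => ∫ t in a..b, F x t := by
  induction n with
  | zero =>
    intro G _ _ _ F hF a b
    rw [Nat.cast_zero, contDiff_zero] at *
    exact intervalIntegral.continuous_parametric_intervalIntegral_of_continuous' hF a b
  | succ n ih =>
    intro G _ _ _ F hF a b
    have hF' : ContDiff ℝ n fun p : E × ℝ =>
        (fderiv ℝ (Function.uncurry F) p).comp (ContinuousLinearMap.inl ℝ E ℝ) :=
      (hF.fderiv_right (by norm_cast)).clm_comp contDiff_const
    rw [Nat.cast_succ, contDiff_succ_iff_hasFDerivAt]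
    refine ⟨_, ih (F := fun x t =>
      (fderiv ℝ (Function.uncurry F) (x, t)).comp (ContinuousLinearMap.inl ℝ E ℝ)) hF' a b,
      fun x => ?_⟩
    refine hasFDerivAt_intervalIntegral_param (F' := fun x t =>
      (fderiv ℝ (Function.uncurry F) (x, t)).comp (ContinuousLinearMap.inl ℝ E ℝ))
      hF.continuous hF'.continuous (fun x t => ?_) a b x
    have h1 : HasFDerivAt (Function.uncurry F) (fderiv ℝ (Function.uncurry F) (x, t)) (x, t) :=
      (hF.differentiable (by simp)).differentiableAt.hasFDerivAt
    exact h1.comp x (f := fun x => (x, t)) (hasFDerivAt_prodMk_left x t)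

/-- The integral of a `C^n` function is `C^n` in the parameters and the upper limit. -/
theorem contDiff_intervalIntegral_upper {n : ℕ} {F : E → ℝ → ℝ}
    (hF : ContDiff ℝ n (Function.uncurry F)) (c : ℝ) {b : E → ℝ} (hb : ContDiff ℝ n b) :
    ContDiff ℝ n fun x => ∫ t in c..b x, F x t := by
  -- Rescaling to the fixed interval [0, 1] moves the variable limit into the integrand; no case
  -- distinction is needed when b x = c.
  have h : (fun x => ∫ t in c..b x, F x t) =
      fun x => (b x - c) * ∫ t in (0 : ℝ)..1, F x (c + (b x - c) * t) := by
    funext x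
    rw [intervalIntegral.mul_integral_comp_add_mul]
    simp
  rw [h]
  refine (hb.sub contDiff_const).mul
    (contDiff_intervalIntegral_param n (F := fun x t => F x (c + (b x - c) * t)) ?_ 0 1)
  have h2 : ContDiff ℝ n fun p : E × ℝ => (p.1, c + (b p.1 - c) * p.2) := by fun_prop
  exact hF.comp h2

end ParametricIntegral

/-- A function of two real variables with `C^n` partial derivatives is `C^(n+1)`. -/
theorem contDiff_succ_of_partial {n : ℕ} {v v₁ v₂ : ℝ × ℝ → ℝ}
    (h₁ : ∀ x y, HasDerivAt (fun x => v (x, y)) (v₁ (x, y)) x)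
    (h₂ : ∀ x y, HasDerivAt (fun y => v (x, y)) (v₂ (x, y)) y)
    (c₁ : ContDiff ℝ n v₁) (c₂ : ContDiff ℝ n v₂) : ContDiff ℝ (n + 1 : ℕ) v := by
  have e₁ : ContDiff ℝ n fun p => ContinuousLinearMap.toSpanSingleton ℝ (v₁ p) :=
    (ContinuousLinearMap.toSpanSingletonCLE (𝕜 := ℝ) (E := ℝ)).contDiff.comp c₁
  have e₂ : ContDiff ℝ n fun p => ContinuousLinearMap.toSpanSingleton ℝ (v₂ p) :=
    (ContinuousLinearMap.toSpanSingletonCLE (𝕜 := ℝ) (E := ℝ)).contDiff.comp c₂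
  rw [Nat.cast_succ, contDiff_succ_iff_hasFDerivAt]
  refine ⟨fun p => (ContinuousLinearMap.toSpanSingleton ℝ (v₁ p)).coprod
    (ContinuousLinearMap.toSpanSingleton ℝ (v₂ p)), ?_, fun p => ?_⟩
  · have : (fun p => (ContinuousLinearMap.toSpanSingleton ℝ (v₁ p)).coprod
        (ContinuousLinearMap.toSpanSingleton ℝ (v₂ p))) =
        fun p => (ContinuousLinearMap.toSpanSingleton ℝ (v₁ p)).comp (.fst ℝ ℝ ℝ) +
          (ContinuousLinearMap.toSpanSingleton ℝ (v₂ p)).comp (.snd ℝ ℝ ℝ) := by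
      funext p
      ext <;> simp
    rw [this]
    exact (e₁.clm_comp contDiff_const).add (e₂.clm_comp contDiff_const)
  · exact (hasStrictFDerivAt_uncurry_coprod (f := fun x y => v (x, y))
      (f₁ := fun x y => ContinuousLinearMap.toSpanSingleton ℝ (v₁ (x, y)))
      (f₂ := fun x y => ContinuousLinearMap.toSpanSingleton ℝ (v₂ (x, y)))
      (.of_forall fun q => (h₁ q.1 q.2).hasFDerivAt) (.of_forall fun q => (h₂ q.1 q.2).hasFDerivAt)
      e₁.continuous.continuousAt e₂.continuous.continuousAt).hasFDerivAt

theorem intervalIntegral_swap_of_continuous {F : ℝ → ℝ → ℝ}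
    (hF : Continuous (Function.uncurry F)) (a b c d : ℝ) :
    ∫ x in a..b, ∫ y in c..d, F x y = ∫ y in c..d, ∫ x in a..b, F x y := by
  refine intervalIntegral_intervalIntegral_swap ?_
  exact (hF.continuousOn.integrableOn_compact (isCompact_uIcc.prod isCompact_uIcc)).mono_set
    (prod_mono uIoc_subset_uIcc uIoc_subset_uIcc)

/-! ### The Goursat problem as a Volterra equation -/

/-- The integral operator of the Goursat problem `y_ξη = Q(ξ + η) y` with vanishing data on
`ξ = 0` and `η = M`. -/
noncomputable def goursatOp (Q : ℝ → ℝ) (M : ℝ) (y : ℝ × ℝ → ℝ) (p : ℝ × ℝ) : ℝ :=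
  ∫ η in M..p.2, ∫ ξ in (0 : ℝ)..p.1, Q (ξ + η) * y (ξ, η)

theorem abs_intervalIntegral_le_pow {f : ℝ → ℝ} {ξ C : ℝ} {n : ℕ}
    (h : ∀ t ∈ uIcc 0 ξ, |f t| ≤ C * |t| ^ n) :
    |∫ t in (0 : ℝ)..ξ, f t| ≤ C * (|ξ| ^ (n + 1) / (n + 1)) := by
  have h1 : ‖∫ t in (0 : ℝ)..ξ, f t‖ ≤ |∫ t in (0 : ℝ)..ξ, C * |t| ^ n| := by
    refine intervalIntegral.norm_integral_le_abs_of_norm_le ?_ ?_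
    · refine (ae_restrict_iff' measurableSet_uIoc).2 (.of_forall fun t ht => ?_)
      exact h t (uIoc_subset_uIcc ht)
    · exact (by fun_prop : Continuous fun t : ℝ => C * |t| ^ n).intervalIntegrable _ _
  have hC : 0 ≤ C * |ξ| ^ n := (abs_nonneg _).trans (h ξ right_mem_uIcc)
  have h2 : ∫ x in uIoc 0 ξ, |x| ^ n = |ξ| ^ (n + 1) / (n + 1) := by
    simpa using integral_pow_abs_sub_uIoc (a := 0) (b := ξ) n
  rw [intervalIntegral.abs_intervalIntegral_eq, integral_const_mul, h2, abs_mul,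
    abs_of_nonneg (a := |ξ| ^ (n + 1) / (n + 1)) (by positivity)] at h1
  refine h1.trans_eq ?_
  rcases eq_or_ne ξ 0 with rfl | hξ
  · simp
  · rw [abs_of_nonneg]
    exact nonneg_of_mul_nonneg_left hC (by positivity)

/-- The Volterra gain: each application raises the power of |ξ| by one and divides by n + 1, while
the η-integral costs only the factor L. Order-connectedness keeps the segments from the base point
inside the sets, so ordered and unordered intervals are both covered. -/
theorem goursatOp_bound {Q : ℝ → ℝ} {M K C L : ℝ} {y : ℝ × ℝ → ℝ} {n : ℕ} {S₁ S₂ : Set ℝ}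
    (o₁ : S₁.OrdConnected) (o₂ : S₂.OrdConnected) (h₁ : (0 : ℝ) ∈ S₁) (h₂ : M ∈ S₂)
    (hL : ∀ η ∈ S₂, |η - M| ≤ L)
    (hQ : ∀ ξ ∈ S₁, ∀ η ∈ S₂, |Q (ξ + η)| ≤ K)
    (hy : ∀ ξ ∈ S₁, ∀ η ∈ S₂, |y (ξ, η)| ≤ C * |ξ| ^ n) :
    ∀ ξ ∈ S₁, ∀ η ∈ S₂, |goursatOp Q M y (ξ, η)| ≤ K * L * C / (n + 1) * |ξ| ^ (n + 1) := by
  intro ξ hξ η hη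
  have hK : 0 ≤ K := (abs_nonneg _).trans (hQ _ hξ _ hη)
  have hb : ∀ s ∈ uIoc M η, ‖∫ t in (0 : ℝ)..ξ, Q (t + s) * y (t, s)‖ ≤
      K * C * (|ξ| ^ (n + 1) / (n + 1)) := fun s hs => by
    refine abs_intervalIntegral_le_pow fun t ht => ?_
    have hs' := o₂.uIcc_subset h₂ hη (uIoc_subset_uIcc hs)
    have ht' := o₁.uIcc_subset h₁ hξ ht
    rw [abs_mul, mul_assoc]
    exact mul_le_mul (hQ t ht' s hs') (hy t ht' s hs') (abs_nonneg _) hK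
  refine (intervalIntegral.norm_integral_le_of_norm_le_const hb).trans ?_
  have h0 : 0 ≤ K * C * (|ξ| ^ (n + 1) / (n + 1)) := by
    have := (abs_nonneg _).trans (hy ξ hξ η hη)
    rw [pow_succ]
    have : 0 ≤ K * (C * |ξ| ^ n) * (|ξ| / (n + 1)) := by positivity
    convert this using 1; ring
  refine (mul_le_mul_of_nonneg_left (hL η hη) h0).trans_eq ?_
  ring

theorem goursatOp_iterate_bound {Q : ℝ → ℝ} {M K C L : ℝ} {y : ℕ → ℝ × ℝ → ℝ} {S₁ S₂ : Set ℝ}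
    (o₁ : S₁.OrdConnected) (o₂ : S₂.OrdConnected) (h₁ : (0 : ℝ) ∈ S₁) (h₂ : M ∈ S₂)
    (hL : ∀ η ∈ S₂, |η - M| ≤ L)
    (hQ : ∀ ξ ∈ S₁, ∀ η ∈ S₂, |Q (ξ + η)| ≤ K)
    (hy : ∀ ξ ∈ S₁, ∀ η ∈ S₂, |y 0 (ξ, η)| ≤ C)
    (hs : ∀ n, ∀ ξ ∈ S₁, ∀ η ∈ S₂, y (n + 1) (ξ, η) = goursatOp Q M (y n) (ξ, η)) (n : ℕ) :
    ∀ ξ ∈ S₁, ∀ η ∈ S₂, |y n (ξ, η)| ≤ C * (K * L) ^ n / n.factorial * |ξ| ^ n := by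
  induction n with
  | zero => simpa using hy
  | succ n ih =>
    intro ξ hξ η hη
    rw [hs n ξ hξ η hη]
    refine (goursatOp_bound o₁ o₂ h₁ h₂ hL hQ ih ξ hξ η hη).trans_eq ?_
    rw [Nat.factorial_succ]
    push_cast
    field_simp
    ring

/-- The iterate bound applied to the constant sequence D bounds D by a term of an exponential series
for every n, and these terms tend to zero. -/
theorem eq_zero_of_eq_goursatOp {Q : ℝ → ℝ} {M K C L : ℝ} {D : ℝ × ℝ → ℝ} {S₁ S₂ : Set ℝ}
    (o₁ : S₁.OrdConnected) (o₂ : S₂.OrdConnected) (h₁ : (0 : ℝ) ∈ S₁) (h₂ : M ∈ S₂)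
    (hL : ∀ η ∈ S₂, |η - M| ≤ L)
    (hQ : ∀ ξ ∈ S₁, ∀ η ∈ S₂, |Q (ξ + η)| ≤ K)
    (hD : ∀ ξ ∈ S₁, ∀ η ∈ S₂, |D (ξ, η)| ≤ C)
    (hs : ∀ ξ ∈ S₁, ∀ η ∈ S₂, D (ξ, η) = goursatOp Q M D (ξ, η)) :
    ∀ ξ ∈ S₁, ∀ η ∈ S₂, D (ξ, η) = 0 := by
  intro ξ hξ η hη
  have hb := fun n => goursatOp_iterate_bound (y := fun _ => D) o₁ o₂ h₁ h₂ hL hQ hD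
    (fun _ => hs) n ξ hξ η hη
  have ht : Tendsto (fun n : ℕ => C * ((K * L * |ξ|) ^ n / n.factorial)) atTop (𝓝 (C * 0)) :=
    (FloorSemiring.tendsto_pow_div_factorial_atTop _).const_mul C
  have h0 : |D (ξ, η)| ≤ C * 0 := ge_of_tendsto' ht fun n => (hb n).trans_eq (by
    rw [mul_pow _ |ξ|]; ring)
  simpa using h0

theorem continuous_goursatOp {Q : ℝ → ℝ} (hQ : Continuous Q) (M : ℝ) {y : ℝ × ℝ → ℝ}
    (hy : Continuous y) : Continuous (goursatOp Q M y) := by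
  refine intervalIntegral.continuous_parametric_intervalIntegral_of_continuous
    (f := fun (p : ℝ × ℝ) η => ∫ ξ in (0 : ℝ)..p.1, Q (ξ + η) * y (ξ, η)) ?_ continuous_snd
  exact intervalIntegral.continuous_parametric_intervalIntegral_of_continuous
    (f := fun (p : (ℝ × ℝ) × ℝ) ξ => Q (ξ + p.2) * y (ξ, p.2)) (by fun_prop)
    (s := fun p => p.1.1) (by fun_prop)

/-- `v` is the regular part of the fundamental solution in characteristic coordinates
`ξ = x + t`, `η = x - t`, for the potential `4 Q(2x)`. -/
structure IsGoursatKernel (Q : ℝ → ℝ) (M : ℝ) (v : ℝ × ℝ → ℝ) : Prop where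
  continuous : Continuous v
  eq : ∀ ξ η, v (ξ, η) = (∫ s in M..η, Q s) + goursatOp Q M v (ξ, η)

theorem exists_isGoursatKernel {Q : ℝ → ℝ} (hQ : Continuous Q) (M : ℝ) :
    ∃ v, IsGoursatKernel Q M v := by
  -- Picard iterates of the data term; their sum will be the kernel, with a summable majorant on
  -- every box.
  let y : ℕ → ℝ × ℝ → ℝ := fun n => (goursatOp Q M)^[n] fun p => ∫ s in M..p.2, Q s
  have ys : ∀ n, y (n + 1) = goursatOp Q M (y n) := fun n => Function.iterate_succ_apply' _ _ _
  have yc : ∀ n, Continuous (y n) := by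
    intro n
    induction n with
    | zero =>
      exact intervalIntegral.continuous_parametric_intervalIntegral_of_continuous
        (f := fun (p : ℝ × ℝ) s => Q s) (by fun_prop) continuous_snd
    | succ n ih => rw [ys]; exact continuous_goursatOp hQ M ih
  have box : ∀ A L : ℝ, 0 ≤ A → 0 ≤ L → ∃ K, 0 ≤ K ∧ (∀ ξ ∈ Icc (-A) A,
      ∀ η ∈ Icc (M - L) (M + L), |Q (ξ + η)| ≤ K) ∧ ∃ c : ℕ → ℝ, Summable c ∧ ∀ n,
      ∀ ξ ∈ Icc (-A) A, ∀ η ∈ Icc (M - L) (M + L), |y n (ξ, η)| ≤ c n := by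
    intro A L hA hL
    have hc : IsCompact (Icc (-A) A ×ˢ Icc (M - L) (M + L)) := isCompact_Icc.prod isCompact_Icc
    obtain ⟨K, hK⟩ := hc.exists_bound_of_continuousOn
      (f := fun p : ℝ × ℝ => Q (p.1 + p.2)) (by fun_prop)
    obtain ⟨C, hC⟩ := hc.exists_bound_of_continuousOn (yc 0).continuousOn
    have m₁ : (0 : ℝ) ∈ Icc (-A) A := ⟨by linarith, hA⟩
    have m₂ : M ∈ Icc (M - L) (M + L) := ⟨by linarith, by linarith⟩
    have hK' : ∀ ξ ∈ Icc (-A) A, ∀ η ∈ Icc (M - L) (M + L), |Q (ξ + η)| ≤ K :=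
      fun ξ hξ η hη => hK (ξ, η) ⟨hξ, hη⟩
    have hK0 : 0 ≤ K := (abs_nonneg _).trans (hK' 0 m₁ M m₂)
    have hC0 : 0 ≤ C := (abs_nonneg _).trans (hC (0, M) ⟨m₁, m₂⟩)
    refine ⟨K, hK0, hK', fun n => C * ((K * L * A) ^ n / n.factorial),
      (Real.summable_pow_div_factorial _).mul_left C, fun n ξ hξ η hη => ?_⟩
    refine (goursatOp_iterate_bound ordConnected_Icc ordConnected_Icc m₁ m₂ (L := L)
      (fun η hη => abs_le.2 ⟨by linarith [hη.1], by linarith [hη.2]⟩) hK'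
      (fun ξ hξ η hη => hC (ξ, η) ⟨hξ, hη⟩) (fun n ξ _ η _ => by rw [ys]) n ξ hξ η hη).trans ?_
    calc C * (K * L) ^ n / n.factorial * |ξ| ^ n ≤ C * (K * L) ^ n / n.factorial * A ^ n := by
          gcongr
          exact abs_le.2 hξ
      _ = C * ((K * L * A) ^ n / n.factorial) := by rw [mul_pow _ A]; ring
  have hsum : ∀ p, HasSum (fun n => y n p) (∑' n, y n p) := by
    rintro ⟨ξ, η⟩
    obtain ⟨K, -, -, c, hc, hb⟩ := box |ξ| |η - M| (abs_nonneg _) (abs_nonneg _)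
    refine (Summable.of_norm_bounded hc fun n => hb n ξ (abs_le.1 le_rfl) η ?_).hasSum
    have := abs_le.1 (le_refl |η - M|)
    exact ⟨by linarith, by linarith⟩
  refine ⟨fun p => ∑' n, y n p, ?_, ?_⟩
  · rw [continuous_iff_continuousAt]
    rintro ⟨ξ, η⟩
    obtain ⟨K, -, -, c, hc, hb⟩ := box (|ξ| + 1) (|η - M| + 1) (by positivity) (by positivity)
    have h1 : ContinuousOn (fun p => ∑' n, y n p)
        (Icc (-(|ξ| + 1)) (|ξ| + 1) ×ˢ Icc (M - (|η - M| + 1)) (M + (|η - M| + 1))) :=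
      continuousOn_tsum (fun n => (yc n).continuousOn) hc fun n p hp => hb n p.1 hp.1 p.2 hp.2
    refine h1.continuousAt (prod_mem_nhds (Icc_mem_nhds ?_ ?_) (Icc_mem_nhds ?_ ?_))
    · linarith [neg_abs_le ξ]
    · linarith [le_abs_self ξ]
    · linarith [neg_abs_le (η - M)]
    · linarith [le_abs_self (η - M)]
  · intro ξ η
    obtain ⟨K, hK0, hK, c, hc, hb⟩ := box |ξ| |η - M| (abs_nonneg _) (abs_nonneg _)
    have o₁ : ∀ t ∈ uIoc 0 ξ, t ∈ Icc (-|ξ|) |ξ| := fun t ht =>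
      ordConnected_Icc.uIcc_subset ⟨by simp, by simp⟩ (abs_le.1 le_rfl) (uIoc_subset_uIcc ht)
    have o₂ : ∀ s ∈ uIoc M η, s ∈ Icc (M - |η - M|) (M + |η - M|) := fun s hs => by
      have := abs_le.1 (le_refl |η - M|)
      exact ordConnected_Icc.uIcc_subset ⟨by simp, by simp⟩ ⟨by linarith, by linarith⟩
        (uIoc_subset_uIcc hs)
    have hin : ∀ s ∈ uIoc M η, HasSum (fun n => ∫ t in (0 : ℝ)..ξ, Q (t + s) * y n (t, s))
        (∫ t in (0 : ℝ)..ξ, Q (t + s) * ∑' n, y n (t, s)) := by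
      intro s hs
      refine intervalIntegral.hasSum_integral_of_dominated_convergence (fun n _ => K * c n)
        (fun n => ?_) (fun n => .of_forall fun t ht => ?_) (.of_forall fun t ht => hc.mul_left K)
        (continuous_const.intervalIntegrable _ _)
        (.of_forall fun t ht => (hsum (t, s)).mul_left _)
      · have := yc n
        exact (by fun_prop : Continuous fun t => Q (t + s) * y n (t, s)).aestronglyMeasurable
      · rw [norm_mul]
        exact mul_le_mul (hK t (o₁ t ht) s (o₂ s hs)) (hb n t (o₁ t ht) s (o₂ s hs))
          (norm_nonneg _) hK0
    have hout : HasSum (fun n => goursatOp Q M (y n) (ξ, η))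
        (goursatOp Q M (fun p => ∑' n, y n p) (ξ, η)) := by
      refine intervalIntegral.hasSum_integral_of_dominated_convergence
        (fun n _ => K * c n * |ξ - 0|)
        (fun n => ?_) (fun n => .of_forall fun s hs => ?_)
        (.of_forall fun t ht => (hc.mul_left K).mul_right _)
        (continuous_const.intervalIntegrable _ _) (.of_forall hin)
      · have := yc n
        exact (intervalIntegral.continuous_parametric_intervalIntegral_of_continuous'
          (f := fun s t => Q (t + s) * y n (t, s)) (by fun_prop) 0 ξ).aestronglyMeasurable
      · refine intervalIntegral.norm_integral_le_of_norm_le_const fun t ht => ?_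
        rw [norm_mul]
        exact mul_le_mul (hK t (o₁ t ht) s (o₂ s hs)) (hb n t (o₁ t ht) s (o₂ s hs))
          (norm_nonneg _) hK0
    -- The series without its first term is the operator applied to the whole series, which is the
    -- fixed point equation.
    have h2 := (hasSum_nat_add_iff' 1).2 (hsum (ξ, η))
    simp only [ys, Finset.sum_range_one] at h2
    have h3 := h2.unique hout
    have h4 : y 0 (ξ, η) = ∫ s in M..η, Q s := rfl
    rw [h4] at h3
    linarith

/-! ### Regularity, support and reflected form of the kernel -/

namespace IsGoursatKernel

variable {Q : ℝ → ℝ} {M : ℝ} {v : ℝ × ℝ → ℝ}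

theorem hasDerivAt_snd (hv : IsGoursatKernel Q M v) (hQ : Continuous Q) (ξ η : ℝ) :
    HasDerivAt (fun η => v (ξ, η)) (Q η + ∫ t in (0 : ℝ)..ξ, Q (t + η) * v (t, η)) η := by
  have hc := hv.continuous
  have h1 : Continuous fun s => ∫ t in (0 : ℝ)..ξ, Q (t + s) * v (t, s) :=
    intervalIntegral.continuous_parametric_intervalIntegral_of_continuous'
      (f := fun s t => Q (t + s) * v (t, s)) (by fun_prop) 0 ξ
  have h2 := ((hQ.integral_hasStrictDerivAt M η).hasDerivAt).add
    (h1.integral_hasStrictDerivAt M η).hasDerivAt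
  refine h2.congr_of_eventuallyEq (.of_forall fun s => ?_)
  exact hv.eq ξ s

theorem hasDerivAt_fst (hv : IsGoursatKernel Q M v) (hQ : Continuous Q) (ξ η : ℝ) :
    HasDerivAt (fun ξ => v (ξ, η)) (∫ s in M..η, Q (ξ + s) * v (ξ, s)) ξ := by
  have hc := hv.continuous
  have h1 : Continuous fun t => ∫ s in M..η, Q (t + s) * v (t, s) :=
    intervalIntegral.continuous_parametric_intervalIntegral_of_continuous'
      (f := fun t s => Q (t + s) * v (t, s)) (by fun_prop) M η
  have h2 := (h1.integral_hasStrictDerivAt 0 ξ).hasDerivAt.const_add (∫ s in M..η, Q s)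
  refine h2.congr_of_eventuallyEq (.of_forall fun t => ?_)
  simp only [hv.eq t η, goursatOp]
  congr 1
  exact intervalIntegral_swap_of_continuous (F := fun s t => Q (t + s) * v (t, s))
    (by fun_prop) _ _ _ _

theorem contDiff_snd {n : ℕ} (hQ : ContDiff ℝ n Q) (hv : ContDiff ℝ n v) :
    ContDiff ℝ n fun p : ℝ × ℝ => Q p.2 + ∫ t in (0 : ℝ)..p.1, Q (t + p.2) * v (t, p.2) := by
  refine (by fun_prop : ContDiff ℝ n fun p : ℝ × ℝ => Q p.2).add
    (contDiff_intervalIntegral_upper (F := fun (p : ℝ × ℝ) t => Q (t + p.2) * v (t, p.2)) ?_ 0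
      _root_.contDiff_fst)
  fun_prop

theorem contDiff_fst {n : ℕ} (hQ : ContDiff ℝ n Q) (hv : ContDiff ℝ n v) :
    ContDiff ℝ n fun p : ℝ × ℝ => ∫ s in M..p.2, Q (p.1 + s) * v (p.1, s) :=
  contDiff_intervalIntegral_upper (F := fun (p : ℝ × ℝ) s => Q (p.1 + s) * v (p.1, s))
    (by fun_prop) M _root_.contDiff_snd

/-- Bootstrap: both partial derivatives are expressed through integrals of Q and v, so they inherit
the order already known for v, which gains one more. -/
theorem contDiff (hv : IsGoursatKernel Q M v) {n : ℕ} (hQ : ContDiff ℝ n Q) :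
    ContDiff ℝ n v := by
  induction n with
  | zero => exact contDiff_zero.2 hv.continuous
  | succ n ih =>
    have hQ' : ContDiff ℝ n Q := hQ.of_le (by norm_cast; omega)
    exact contDiff_succ_of_partial (fun ξ η => hv.hasDerivAt_fst hQ.continuous ξ η)
      (fun ξ η => hv.hasDerivAt_snd hQ.continuous ξ η) (contDiff_fst hQ' (ih hQ'))
      (contDiff_snd hQ' (ih hQ'))

/-- For ξ ≥ 0 and η ≥ M both terms of the integral equation sample Q only at arguments at least M.
-/
theorem eq_zero (hv : IsGoursatKernel Q M v) (hQ : ∀ s, M ≤ s → Q s = 0) {ξ η : ℝ}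
    (hξ : 0 ≤ ξ) (hη : M ≤ η) : v (ξ, η) = 0 := by
  rw [hv.eq, goursatOp, intervalIntegral.integral_zero_ae, intervalIntegral.integral_zero_ae,
    add_zero]
  · refine .of_forall fun s hs => intervalIntegral.integral_zero_ae (.of_forall fun t ht => ?_)
    rw [uIoc_of_le hη] at hs
    rw [uIoc_of_le hξ] at ht
    rw [hQ _ (by linarith [hs.1, ht.1]), zero_mul]
  · refine .of_forall fun s hs => ?_
    rw [uIoc_of_le hη] at hs
    exact hQ s hs.1.le

/-- Away from the potential the kernel is a purely reflected wave. -/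
theorem eq_reflected (hv : IsGoursatKernel Q M v) (hQc : Continuous Q)
    (hQ : ∀ s, M ≤ s → Q s = 0) (hM : 0 ≤ M) {ξ η : ℝ} (hξ : 0 ≤ ξ) (hη : 0 ≤ η) (h : M ≤ ξ + η) :
    v (ξ, η) = v (M, η) := by
  have hc := hv.continuous
  have h1 := intervalIntegral.integral_eq_sub_of_hasDerivAt (a := M) (b := ξ)
    (fun t _ => hv.hasDerivAt_fst hQc t η)
    (Continuous.intervalIntegrable
      (intervalIntegral.continuous_parametric_intervalIntegral_of_continuous'
      (f := fun t s => Q (t + s) * v (t, s)) (by fun_prop) M η) _ _)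
  rw [intervalIntegral.integral_zero_ae] at h1
  · linarith
  · refine .of_forall fun t ht => intervalIntegral.integral_zero_ae (.of_forall fun s hs => ?_)
    rw [hQ _ ?_, zero_mul]
    rcases mem_uIoc.1 ht with ht | ht <;> rcases mem_uIoc.1 hs with hs | hs <;> linarith

/-- For ξ, η ≥ 0 the equation sees Q only on [0, ∞), so the difference of the kernels solves the
homogeneous equation. This makes the choice of extension of the potential to negative arguments
irrelevant. -/
theorem eq_of_eqOn {Q' : ℝ → ℝ} {v' : ℝ × ℝ → ℝ} (hv : IsGoursatKernel Q M v)
    (hv' : IsGoursatKernel Q' M v') (hM : 0 ≤ M) (hQc : Continuous Q)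
    (hQ : ∀ s, 0 ≤ s → Q s = Q' s) {ξ η : ℝ} (hξ : 0 ≤ ξ) (hη : 0 ≤ η) :
    v (ξ, η) = v' (ξ, η) := by
  have hc := hv.continuous
  have hc' := hv'.continuous
  have hcomp : IsCompact (Icc 0 ξ ×ˢ uIcc M η) := isCompact_Icc.prod isCompact_uIcc
  obtain ⟨K, hK⟩ := hcomp.exists_bound_of_continuousOn
    (f := fun p : ℝ × ℝ => Q (p.1 + p.2)) (by fun_prop)
  obtain ⟨C, hC⟩ := hcomp.exists_bound_of_continuousOn (f := fun p => v p - v' p) (by fun_prop)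
  have hpos : ∀ s ∈ uIcc M η, 0 ≤ s := fun s hs => (le_min hM hη).trans hs.1
  have h0 := eq_zero_of_eq_goursatOp (Q := Q) (M := M) (D := fun p => v p - v' p)
    (L := |η - M|) ordConnected_Icc ordConnected_uIcc
    (left_mem_Icc.2 hξ) left_mem_uIcc (fun s hs => abs_sub_left_of_mem_uIcc hs)
    (fun t ht s hs => hK (t, s) ⟨ht, hs⟩) (fun t ht s hs => hC (t, s) ⟨ht, hs⟩)
    (fun t ht s hs => ?_) ξ (right_mem_Icc.2 hξ) η right_mem_uIcc
  · exact sub_eq_zero.1 h0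
  · have hs0 := hpos s hs
    have hmem : ∀ σ ∈ uIcc M s, 0 ≤ σ := fun σ hσ => (le_min hM hs0).trans hσ.1
    have e1 : ∫ σ in M..s, Q' σ = ∫ σ in M..s, Q σ :=
      intervalIntegral.integral_congr fun σ hσ => (hQ σ (hmem σ hσ)).symm
    have e2 : goursatOp Q' M v' (t, s) = goursatOp Q M v' (t, s) := by
      refine intervalIntegral.integral_congr fun σ hσ =>
        intervalIntegral.integral_congr fun τ hτ => ?_
      rw [uIcc_of_le ht.1] at hτ
      rw [hQ _ (add_nonneg hτ.1 (hmem σ hσ))]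
    rw [hv.eq, hv'.eq, e1, e2, add_sub_add_left_eq_sub]
    have i1 : ∀ u : ℝ × ℝ → ℝ, Continuous u → Continuous fun σ =>
        ∫ τ in (0 : ℝ)..t, Q (τ + σ) * u (τ, σ) := fun u hu =>
      intervalIntegral.continuous_parametric_intervalIntegral_of_continuous'
        (f := fun σ τ => Q (τ + σ) * u (τ, σ)) (by fun_prop) 0 t
    simp only [goursatOp]
    rw [← intervalIntegral.integral_sub ((i1 v hc).intervalIntegrable _ _)
      ((i1 v' hc').intervalIntegrable _ _)]
    refine intervalIntegral.integral_congr fun σ hσ => ?_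
    rw [← intervalIntegral.integral_sub
      ((by fun_prop : Continuous fun τ => Q (τ + σ) * v (τ, σ)).intervalIntegrable _ _)
      ((by fun_prop : Continuous fun τ => Q (τ + σ) * v' (τ, σ)).intervalIntegrable _ _)]
    simp only [mul_sub]

end IsGoursatKernel

/-! ### Extension from the half-line and differentiation rules -/

/-- A smooth function on the half-line extends to a `C^n` function on the line. -/
theorem exists_contDiff_extension (n : ℕ) : ∀ {q : ℝ → ℝ}, ContDiffOn ℝ ∞ q (Ici 0) →
    ∃ g : ℝ → ℝ, ContDiff ℝ n g ∧ ∀ x, 0 ≤ x → g x = q x := by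
  induction n with
  | zero =>
    intro q hq
    refine ⟨fun x => q (max x 0), ?_, fun x hx => congrArg q (max_eq_left hx)⟩
    rw [Nat.cast_zero, contDiff_zero]
    exact hq.continuousOn.comp_continuous (by fun_prop) fun x => le_max_right x 0
  | succ n ih =>
    intro q hq
    have h1 := (contDiffOn_infty_iff_derivWithin (uniqueDiffOn_Ici (0 : ℝ))).1 hq
    -- An extension of the derivative is integrated back. Each order gets its own extension; no
    -- single smooth one is constructed.
    obtain ⟨g, hg, hgq⟩ := ih h1.2
    have hd : ∀ x, HasDerivAt (fun x => q 0 + ∫ t in (0 : ℝ)..x, g t) (g x) x := fun x =>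
      (hg.continuous.integral_hasStrictDerivAt 0 x).hasDerivAt.const_add _
    refine ⟨fun x => q 0 + ∫ t in (0 : ℝ)..x, g t, ?_, fun x hx => ?_⟩
    · rw [Nat.cast_succ, contDiff_succ_iff_deriv]
      refine ⟨fun x => (hd x).differentiableAt, by simp, ?_⟩
      rwa [show deriv (fun x => q 0 + ∫ t in (0 : ℝ)..x, g t) = g from funext fun x => (hd x).deriv]
    · have h2 := intervalIntegral.integral_eq_sub_of_hasDeriv_right_of_le hx
        (hq.continuousOn.mono Icc_subset_Ici_self) (f' := g) (fun t ht => ?_)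
        (hg.continuous.intervalIntegrable _ _)
      · simp only [h2]; ring
      · rw [hgq t ht.1.le]
        exact (h1.1 t ht.1.le).hasDerivWithinAt.mono fun s hs => ht.1.le.trans (le_of_lt hs)

/-- The chain rule along a curve, from continuous partial derivatives. -/
theorem hasDerivAt_comp_of_partial {v v₁ v₂ : ℝ × ℝ → ℝ}
    (h₁ : ∀ x y, HasDerivAt (fun x => v (x, y)) (v₁ (x, y)) x)
    (h₂ : ∀ x y, HasDerivAt (fun y => v (x, y)) (v₂ (x, y)) y)
    (c₁ : Continuous v₁) (c₂ : Continuous v₂) {a b : ℝ → ℝ} {a' b' s : ℝ}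
    (ha : HasDerivAt a a' s) (hb : HasDerivAt b b' s) :
    HasDerivAt (fun s => v (a s, b s)) (v₁ (a s, b s) * a' + v₂ (a s, b s) * b') s := by
  have e₁ : Continuous fun p => ContinuousLinearMap.toSpanSingleton ℝ (v₁ p) :=
    (ContinuousLinearMap.toSpanSingletonCLE (𝕜 := ℝ) (E := ℝ)).continuous.comp c₁
  have e₂ : Continuous fun p => ContinuousLinearMap.toSpanSingleton ℝ (v₂ p) :=
    (ContinuousLinearMap.toSpanSingletonCLE (𝕜 := ℝ) (E := ℝ)).continuous.comp c₂
  have h := (hasStrictFDerivAt_uncurry_coprod (u := (a s, b s)) (f := fun x y => v (x, y))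
      (f₁ := fun x y => ContinuousLinearMap.toSpanSingleton ℝ (v₁ (x, y)))
      (f₂ := fun x y => ContinuousLinearMap.toSpanSingleton ℝ (v₂ (x, y)))
      (.of_forall fun q => (h₁ q.1 q.2).hasFDerivAt) (.of_forall fun q => (h₂ q.1 q.2).hasFDerivAt)
      e₁.continuousAt e₂.continuousAt).hasFDerivAt
  have h' := h.comp_hasDerivAt s (ha.prodMk hb)
  refine h'.congr_deriv ?_
  simp [Function.HasUncurry.uncurry, mul_comm]

/-- The Leibniz rule for an integral whose upper limit and integrand depend on the variable. -/
theorem hasDerivAt_integral_leibniz {H H' : ℝ → ℝ → ℝ} (hH : Continuous (Function.uncurry H))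
    (hH' : Continuous (Function.uncurry H')) (h : ∀ x t, HasDerivAt (fun x => H x t) (H' x t) x)
    (c x : ℝ) :
    HasDerivAt (fun x => ∫ t in c..x, H x t) (H x x + ∫ t in c..x, H' x t) x := by
  have := hasDerivAt_comp_of_partial (v := fun p => ∫ t in c..p.2, H p.1 t)
    (v₁ := fun p => ∫ t in c..p.2, H' p.1 t) (v₂ := fun p => H p.1 p.2)
    (fun x y => hasDerivAt_intervalIntegral_param hH hH' h c y x)
    (fun x y => ((hH.comp (Continuous.prodMk_right x)).integral_hasStrictDerivAt c y).hasDerivAt)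
    (intervalIntegral.continuous_parametric_intervalIntegral_of_continuous
      (f := fun (p : ℝ × ℝ) t => H' p.1 t)
      (hH'.comp (by fun_prop : Continuous fun p : (ℝ × ℝ) × ℝ => (p.1.1, p.2))) continuous_snd)
    hH (hasDerivAt_id x) (hasDerivAt_id x)
  refine this.congr_deriv ?_
  simp [add_comm]

/-! ### Waves in characteristic coordinates -/

/-- The derivative of a Goursat kernel in the first characteristic coordinate. -/
noncomputable def kernelFst (Q : ℝ → ℝ) (M : ℝ) (v : ℝ × ℝ → ℝ) (p : ℝ × ℝ) : ℝ :=
  ∫ s in M..p.2, Q (p.1 + s) * v (p.1, s)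

/-- The derivative of a Goursat kernel in the second characteristic coordinate. -/
noncomputable def kernelSnd (Q : ℝ → ℝ) (v : ℝ × ℝ → ℝ) (p : ℝ × ℝ) : ℝ :=
  Q p.2 + ∫ t in (0 : ℝ)..p.1, Q (t + p.2) * v (t, p.2)

theorem kernelSnd_zero (Q : ℝ → ℝ) (v : ℝ × ℝ → ℝ) (η : ℝ) : kernelSnd Q v (0, η) = Q η := by
  simp [kernelSnd]

theorem continuous_kernelFst {Q : ℝ → ℝ} {M : ℝ} {v : ℝ × ℝ → ℝ} (hQ : Continuous Q)
    (hv : Continuous v) : Continuous (kernelFst Q M v) :=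
  intervalIntegral.continuous_parametric_intervalIntegral_of_continuous
    (f := fun (p : ℝ × ℝ) s => Q (p.1 + s) * v (p.1, s)) (by fun_prop) continuous_snd

theorem continuous_kernelSnd {Q : ℝ → ℝ} {v : ℝ × ℝ → ℝ} (hQ : Continuous Q)
    (hv : Continuous v) : Continuous (kernelSnd Q v) :=
  (hQ.comp continuous_snd).add
    (intervalIntegral.continuous_parametric_intervalIntegral_of_continuous
      (f := fun (p : ℝ × ℝ) t => Q (t + p.2) * v (t, p.2)) (by fun_prop) continuous_fst)

theorem hasDerivAt_kernelSnd_fst {Q : ℝ → ℝ} {v : ℝ × ℝ → ℝ} (hQ : Continuous Q)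
    (hv : Continuous v) (ξ η : ℝ) :
    HasDerivAt (fun ξ => kernelSnd Q v (ξ, η)) (Q (ξ + η) * v (ξ, η)) ξ :=
  ((by fun_prop : Continuous fun t => Q (t + η) * v (t, η)).integral_hasStrictDerivAt
    0 ξ).hasDerivAt.const_add (Q η)

theorem hasDerivAt_kernelFst_snd {Q : ℝ → ℝ} {M : ℝ} {v : ℝ × ℝ → ℝ} (hQ : Continuous Q)
    (hv : Continuous v) (ξ η : ℝ) :
    HasDerivAt (fun η => kernelFst Q M v (ξ, η)) (Q (ξ + η) * v (ξ, η)) η :=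
  ((by fun_prop : Continuous fun s => Q (ξ + s) * v (ξ, s)).integral_hasStrictDerivAt
    M η).hasDerivAt

/-- The wave with control `f` in characteristic coordinates. -/
noncomputable def goursatWave (v : ℝ × ℝ → ℝ) (f : ℝ → ℝ) (p : ℝ × ℝ) : ℝ :=
  f p.1 + ∫ s in (0 : ℝ)..p.1, v (p.1 - s, p.2 + s) * f s

theorem contDiff_goursatWave {n : ℕ} {v : ℝ × ℝ → ℝ} {f : ℝ → ℝ} (hv : ContDiff ℝ n v)
    (hf : ContDiff ℝ n f) : ContDiff ℝ n (goursatWave v f) := by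
  refine (by fun_prop : ContDiff ℝ n fun p : ℝ × ℝ => f p.1).add
    (contDiff_intervalIntegral_upper
      (F := fun (p : ℝ × ℝ) s => v (p.1 - s, p.2 + s) * f s) ?_ 0 contDiff_fst)
  exact (hv.comp (by fun_prop : ContDiff ℝ n fun p : (ℝ × ℝ) × ℝ =>
    (p.1.1 - p.2, p.1.2 + p.2))).mul (hf.comp contDiff_snd)

theorem IsGoursatKernel.hasDerivAt_goursatWave_snd {Q : ℝ → ℝ} {M : ℝ} {v : ℝ × ℝ → ℝ}
    (hv : IsGoursatKernel Q M v) (hQ : Continuous Q) {f : ℝ → ℝ} (hf : Continuous f) (ξ η : ℝ) :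
    HasDerivAt (fun η => goursatWave v f (ξ, η))
      (∫ s in (0 : ℝ)..ξ, kernelSnd Q v (ξ - s, η + s) * f s) η := by
  have hc := hv.continuous
  have hs := continuous_kernelSnd hQ hc
  refine (hasDerivAt_intervalIntegral_param (F := fun η s => v (ξ - s, η + s) * f s)
    (F' := fun η s => kernelSnd Q v (ξ - s, η + s) * f s) (by fun_prop) (by fun_prop)
    (fun η s => HasDerivAt.mul_const ?_ _) 0 ξ η).const_add (f ξ)
  exact (hv.hasDerivAt_snd hQ (ξ - s) (η + s)).comp_add_const η s

/-- The moving endpoint contributes v_η(0, ξ + η) f(ξ) = Q(ξ + η) f(ξ), exactly the potential acting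
on the unscattered part f(ξ). Under the integral the argument ξ − s + (η + s) does not depend on s,
so Q factors out. -/
theorem IsGoursatKernel.hasDerivAt_goursatWave_mixed {Q : ℝ → ℝ} {M : ℝ} {v : ℝ × ℝ → ℝ}
    (hv : IsGoursatKernel Q M v) (hQ : Continuous Q) {f : ℝ → ℝ} (hf : Continuous f) (ξ η : ℝ) :
    HasDerivAt (fun ξ => ∫ s in (0 : ℝ)..ξ, kernelSnd Q v (ξ - s, η + s) * f s)
      (Q (ξ + η) * goursatWave v f (ξ, η)) ξ := by
  have hc := hv.continuous
  have hs := continuous_kernelSnd hQ hc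
  have h := hasDerivAt_integral_leibniz
    (H := fun ξ s => kernelSnd Q v (ξ - s, η + s) * f s)
    (H' := fun ξ s => Q (ξ + η) * (v (ξ - s, η + s) * f s)) (by fun_prop) (by fun_prop)
    (fun ξ s => ?_) 0 ξ
  · refine h.congr_deriv ?_
    rw [intervalIntegral.integral_const_mul, sub_self, kernelSnd_zero, goursatWave, add_comm η ξ]
    ring
  · have h1 := ((hasDerivAt_kernelSnd_fst hQ hc (ξ - s) (η + s)).comp_sub_const ξ s).mul_const (f s)
    refine h1.congr_deriv ?_
    rw [show ξ - s + (η + s) = ξ + η by ring]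
    ring

theorem iteratedDeriv_two_comp_affine {U : ℝ × ℝ → ℝ} {c d : ℝ × ℝ} {t : ℝ}
    (hU : ContDiffAt ℝ 2 U (c + t • d)) :
    iteratedDeriv 2 (fun s => U (c + s • d)) t = fderiv ℝ (fderiv ℝ U) (c + t • d) d d := by
  have hγ : ∀ s : ℝ, HasDerivAt (fun s : ℝ => c + s • d) d s := fun s => by
    simpa using ((hasDerivAt_id s).smul_const d).const_add c
  have h1 : ∀ᶠ p in 𝓝 (c + t • d), DifferentiableAt ℝ U p := by
    filter_upwards [hU.eventually (by simp)] with p hp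
    exact hp.differentiableAt (by simp)
  have h2 : deriv (fun s => U (c + s • d)) =ᶠ[𝓝 t] fun s => fderiv ℝ U (c + s • d) d := by
    filter_upwards [(hγ t).continuousAt.eventually h1] with s hs
    exact (hs.hasFDerivAt.comp_hasDerivAt s (hγ s)).deriv
  rw [iteratedDeriv_succ, iteratedDeriv_one, h2.deriv_eq]
  have h3 : DifferentiableAt ℝ (fderiv ℝ U) (c + t • d) :=
    (hU.fderiv_right (m := 1) (by norm_num)).differentiableAt (by simp)
  have h4 : HasDerivAt (fun s : ℝ => fderiv ℝ U (c + s • d))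
      (fderiv ℝ (fderiv ℝ U) (c + t • d) d) t := h3.hasFDerivAt.comp_hasDerivAt t (hγ t)
  exact (((ContinuousLinearMap.apply ℝ ℝ d).hasFDerivAt).comp_hasDerivAt t h4).deriv

/-- The wave operator in characteristic coordinates. -/
theorem waveOp_characteristic (q : ℝ → ℝ) {U : ℝ × ℝ → ℝ} {x t : ℝ}
    (hU : ContDiffAt ℝ 2 U (x + t, x - t)) :
    waveOp q (fun x t => U (x + t, x - t)) x t =
      -4 * fderiv ℝ (fderiv ℝ U) (x + t, x - t) (1, 0) (0, 1) + q x * U (x + t, x - t) := by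
  have e1 : ∀ s, (x + s, x - s) = ((x, x) : ℝ × ℝ) + s • ((1, -1) : ℝ × ℝ) := fun s => by
    ext <;> simp [sub_eq_add_neg]
  have e2 : ∀ y, (y + t, y - t) = ((t, -t) : ℝ × ℝ) + y • ((1, 1) : ℝ × ℝ) := fun y => by
    ext <;> simp <;> ring
  have h1 := iteratedDeriv_two_comp_affine (U := U) (c := (x, x)) (d := (1, -1)) (t := t)
    (by rwa [← e1])
  have h2 := iteratedDeriv_two_comp_affine (U := U) (c := (t, -t)) (d := (1, 1)) (t := x)
    (by rwa [← e2])
  simp only [← e1] at h1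
  simp only [← e2] at h2
  rw [waveOp, h1, h2]
  have d1 : ((1, -1) : ℝ × ℝ) = (1, 0) - (0, 1) := by ext <;> simp
  have d2 : ((1, 1) : ℝ × ℝ) = (1, 0) + (0, 1) := by ext <;> simp
  have hs := (hU.isSymmSndFDerivAt (by simp)) (1, 0) (0, 1)
  rw [d1, d2]
  simp only [map_add, map_sub, add_apply, sub_apply]
  rw [hs]
  ring

theorem hasDerivAt_fst_of_differentiableAt {U : ℝ × ℝ → ℝ} {ξ η : ℝ}
    (h : DifferentiableAt ℝ U (ξ, η)) :
    HasDerivAt (fun ξ => U (ξ, η)) (fderiv ℝ U (ξ, η) (1, 0)) ξ :=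
  h.hasFDerivAt.comp_hasDerivAt ξ ((hasDerivAt_id ξ).prodMk (hasDerivAt_const ξ η))

theorem hasDerivAt_snd_of_differentiableAt {U : ℝ × ℝ → ℝ} {ξ η : ℝ}
    (h : DifferentiableAt ℝ U (ξ, η)) :
    HasDerivAt (fun η => U (ξ, η)) (fderiv ℝ U (ξ, η) (0, 1)) η :=
  h.hasFDerivAt.comp_hasDerivAt η ((hasDerivAt_const η ξ).prodMk (hasDerivAt_id η))

theorem hasDerivAt_fderiv_snd {U : ℝ × ℝ → ℝ} {ξ η : ℝ} (hU : ContDiffAt ℝ 2 U (ξ, η)) :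
    HasDerivAt (fun ξ => fderiv ℝ U (ξ, η) (0, 1))
      (fderiv ℝ (fderiv ℝ U) (ξ, η) (1, 0) (0, 1)) ξ := by
  have h3 : DifferentiableAt ℝ (fderiv ℝ U) (ξ, η) :=
    (hU.fderiv_right (m := 1) (by norm_num)).differentiableAt (by simp)
  have h4 : HasDerivAt (fun ξ : ℝ => fderiv ℝ U (ξ, η))
      (fderiv ℝ (fderiv ℝ U) (ξ, η) (1, 0)) ξ :=
    h3.hasFDerivAt.comp_hasDerivAt ξ ((hasDerivAt_id ξ).prodMk (hasDerivAt_const ξ η))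
  exact ((ContinuousLinearMap.apply ℝ ℝ ((0, 1) : ℝ × ℝ)).hasFDerivAt).comp_hasDerivAt ξ h4

theorem IsGoursatKernel.mixed_goursatWave {Q : ℝ → ℝ} {M : ℝ} {v : ℝ × ℝ → ℝ}
    (hv : IsGoursatKernel Q M v) (hQ : ContDiff ℝ 2 Q) {f : ℝ → ℝ} (hf : ContDiff ℝ 2 f)
    (ξ η : ℝ) :
    fderiv ℝ (fderiv ℝ (goursatWave v f)) (ξ, η) (1, 0) (0, 1) =
      Q (ξ + η) * goursatWave v f (ξ, η) := by
  have hU : ContDiff ℝ 2 (goursatWave v f) :=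
    contDiff_goursatWave (n := 2) (hv.contDiff (n := 2) hQ) hf
  have h1 : ∀ ξ, fderiv ℝ (goursatWave v f) (ξ, η) (0, 1) =
      ∫ s in (0 : ℝ)..ξ, kernelSnd Q v (ξ - s, η + s) * f s := fun ξ =>
    (hasDerivAt_snd_of_differentiableAt (hU.differentiable (by simp) _)).unique
      (hv.hasDerivAt_goursatWave_snd hQ.continuous hf.continuous ξ η)
  have h2 := hasDerivAt_fderiv_snd (hU.contDiffAt (x := (ξ, η)))
  simp only [h1] at h2
  exact h2.unique (hv.hasDerivAt_goursatWave_mixed hQ.continuous hf.continuous ξ η)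

/-! ### Classical solutions: existence and uniqueness -/

/-- The regular part of the fundamental solution, from its expression in characteristic
coordinates. -/
noncomputable def regularPart (v : ℝ × ℝ → ℝ) (x t : ℝ) : ℝ :=
  if t < -x then 0 else v (x + t, x - t)

/-- The Duhamel integral samples the kernel only at nonnegative first and at least x − t second
coordinate. Hence v may be replaced by any V agreeing with it there, in particular by a smoother
one. -/
theorem wave_regularPart_eq {v V : ℝ × ℝ → ℝ} {f F : ℝ → ℝ} {x t : ℝ}
    (hF : ∀ τ, 0 ≤ τ → F τ = f τ) (hF0 : ∀ τ, τ < 0 → F τ = 0)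
    (h : ∀ ξ η, 0 ≤ ξ → x - t ≤ η → v (ξ, η) = V (ξ, η)) :
    wave (regularPart v) f x t = goursatWave V F (x + t, x - t) := by
  rw [wave, goursatWave]
  split_ifs with h0
  · rw [hF _ h0]
    congr 1
    refine intervalIntegral.integral_congr fun s hs => ?_
    rw [uIcc_of_le h0] at hs
    have h1 : ¬ t - s < -x := by linarith [hs.2]
    simp only [regularPart, if_neg h1]
    rw [hF s hs.1, ← h _ _ (by linarith [hs.2]) (by linarith [hs.1]),
      show x + (t - s) = x + t - s by ring, show x - (t - s) = x - t + s by ring]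
  · rw [not_le] at h0
    rw [hF0 _ h0, intervalIntegral.integral_zero_ae, add_zero]
    -- The interval of integration contains the endpoint 0, where F need not vanish; it is a null
    -- set.
    have : ∀ᵐ s : ℝ, s ≠ 0 := Measure.ae_ne volume 0
    filter_upwards [this] with s hs0 hs
    rw [uIoc_of_ge h0.le] at hs
    rw [hF0 s (lt_of_le_of_ne hs.2 hs0), mul_zero]

theorem IsSmoothControl.exists_extension {f : ℝ → ℝ} (hf : IsSmoothControl f) :
    ∃ F : ℝ → ℝ, ContDiff ℝ ∞ F ∧ (∀ τ, 0 ≤ τ → F τ = f τ) ∧ ∀ τ, τ < 0 → F τ = 0 := by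
  obtain ⟨ε, hε, h0⟩ := hf.vanish
  refine ⟨fun τ => if 0 ≤ τ then f τ else 0, contDiff_iff_contDiffAt.2 fun τ => ?_,
    fun τ hτ => if_pos hτ, fun τ hτ => if_neg (not_le.2 hτ)⟩
  rcases lt_or_ge τ ε with h | h
  · refine (contDiffAt_const (c := (0 : ℝ))).congr_of_eventuallyEq ?_
    filter_upwards [Iio_mem_nhds h] with s hs
    split_ifs with h1
    · exact h0 s h1 (le_of_lt hs)
    · rfl
  · have hτ : 0 < τ := hε.trans_le h
    refine (hf.smooth.contDiffAt (Ici_mem_nhds hτ)).congr_of_eventuallyEq ?_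
    filter_upwards [Ioi_mem_nhds hτ] with s hs
    exact if_pos (le_of_lt hs)

theorem two_le_infty : (2 : WithTop ℕ∞) ≤ ∞ := WithTop.coe_le_coe.2 le_top

theorem isOpen_domain : IsOpen domain :=
  (isOpen_lt continuous_const continuous_fst).inter (isOpen_lt continuous_snd continuous_fst)

/-- The equation is checked with the C² kernel v itself, smoothness with a C^n substitute for each
n. Along (s, τ − s) the kernel is evaluated at η ≥ 2s − τ, so for large s the scattered part
vanishes and the wave equals f(τ) exactly. -/
theorem isClassicalSolution_wave {q Q : ℝ → ℝ} {M : ℝ} {v : ℝ × ℝ → ℝ}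
    (hv : IsGoursatKernel Q M v) (hQ : ContDiff ℝ 2 Q) (hQ0 : ∀ s, M ≤ s → Q s = 0)
    (hq : ∀ x, 0 < x → Q (x + x) = q x / 4)
    (hsm : ∀ n : ℕ, ∃ V : ℝ × ℝ → ℝ, ContDiff ℝ n V ∧
      ∀ ξ η, 0 ≤ ξ → 0 ≤ η → v (ξ, η) = V (ξ, η))
    {f : ℝ → ℝ} (hf : IsSmoothControl f) :
    IsClassicalSolution q f (wave (regularPart v) f) := by
  obtain ⟨F, hFs, hF, hF0⟩ := hf.exists_extension
  have hw : wave (regularPart v) f = fun x t => goursatWave v F (x + t, x - t) := by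
    funext x t
    exact wave_regularPart_eq hF hF0 fun _ _ _ _ => rfl
  refine ⟨?_, fun x t hx ht => ?_, fun x t hx ht => ?_, fun τ hτ => ?_⟩
  · rw [contDiffOn_infty]
    intro n
    obtain ⟨V, hV, hvV⟩ := hsm n
    have h1 : ContDiff ℝ n fun p : ℝ × ℝ => goursatWave V F (p.1 + p.2, p.1 - p.2) :=
      (contDiff_goursatWave hV (hFs.of_le (by exact_mod_cast le_top))).comp
        (by fun_prop : ContDiff ℝ n fun p : ℝ × ℝ => (p.1 + p.2, p.1 - p.2))
    refine h1.contDiffOn.congr fun p hp => ?_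
    exact wave_regularPart_eq hF hF0 fun ξ η h1 h2 => hvV ξ η h1 (by linarith [hp.2])
  · have hF2 : ContDiff ℝ 2 F := hFs.of_le two_le_infty
    rw [hw, waveOp_characteristic q (contDiff_goursatWave (n := 2) (hv.contDiff (n := 2) hQ)
      hF2).contDiffAt, hv.mixed_goursatWave hQ hF2, show x + t + (x - t) = x + x by ring, hq x hx]
    ring
  · rw [wave, if_neg (by linarith)]
  · refine tendsto_const_nhds.congr' ?_
    filter_upwards [eventually_ge_atTop ((M + τ) / 2)] with s hs
    rw [hw]
    simp only [goursatWave]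
    rw [show s + (τ - s) = τ by ring, hF τ hτ, intervalIntegral.integral_zero_ae, add_zero]
    refine .of_forall fun y hy => ?_
    rw [uIoc_of_le hτ] at hy
    rw [hv.eq_zero hQ0 (by linarith [hy.2]) (by linarith [hy.1]), zero_mul]

theorem IsClassicalSolution.sub {q f g : ℝ → ℝ} {u u' : ℝ → ℝ → ℝ}
    (h : IsClassicalSolution q f u) (h' : IsClassicalSolution q g u') :
    IsClassicalSolution q (f - g) (fun x t => u x t - u' x t) := by
  refine ⟨h.smooth.sub h'.smooth, fun x t hx ht => ?_, fun x t hx ht => ?_, fun τ hτ =>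
    (h.incoming τ hτ).sub (h'.incoming τ hτ)⟩
  · have hmem : domain ∈ 𝓝 (x, t) := isOpen_domain.mem_nhds ⟨hx, ht⟩
    have c1 : ∀ {U : ℝ → ℝ → ℝ}, ContDiffOn ℝ ∞ (fun p : ℝ × ℝ => U p.1 p.2) domain →
        ContDiffAt ℝ 2 (fun s => U x s) t := fun {U} hU =>
      ((hU.contDiffAt hmem).of_le two_le_infty).comp t (f := fun s : ℝ => (x, s))
        (by fun_prop : ContDiffAt ℝ 2 (fun s : ℝ => (x, s)) t)
    have c2 : ∀ {U : ℝ → ℝ → ℝ}, ContDiffOn ℝ ∞ (fun p : ℝ × ℝ => U p.1 p.2) domain →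
        ContDiffAt ℝ 2 (fun y => U y t) x := fun {U} hU =>
      ((hU.contDiffAt hmem).of_le two_le_infty).comp x (f := fun s : ℝ => (s, t))
        (by fun_prop : ContDiffAt ℝ 2 (fun s : ℝ => (s, t)) x)
    have e := h.equation x t hx ht
    have e' := h'.equation x t hx ht
    rw [waveOp] at *
    rw [iteratedDeriv_fun_sub (c1 h.smooth) (c1 h'.smooth),
      iteratedDeriv_fun_sub (c2 h.smooth) (c2 h'.smooth)]
    linarith
  · simp only [h.causal x t hx ht, h'.causal x t hx ht, sub_self]

/-- Causality and continuity give zero data on ξ = 0; the vanishing incoming wave gives zero data on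
a line η = const beyond the potential. Integrating the equation twice from these two lines leaves
the homogeneous Volterra equation. -/
theorem IsClassicalSolution.eq_zero {q : ℝ → ℝ} {Q : ℝ → ℝ} {M : ℝ} (hM : 0 ≤ M)
    (hQc : Continuous Q) (hQ0 : ∀ s, M ≤ s → Q s = 0)
    (hq : ∀ x, 0 < x → Q (x + x) = q x / 4) {u : ℝ → ℝ → ℝ}
    (hu : IsClassicalSolution q 0 u) {x t : ℝ} (hx : 0 < x) (ht : t < x) : u x t = 0 := by
  set U : ℝ × ℝ → ℝ := fun p => u ((p.1 + p.2) / 2) ((p.1 - p.2) / 2) with hU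
  have huU : u = fun x t => U (x + t, x - t) := by
    funext x t
    simp only [hU]
    congr 1 <;> ring
  set Ω : Set (ℝ × ℝ) := {p | 0 < p.1 + p.2 ∧ 0 < p.2} with hΩ
  have hΩo : IsOpen Ω := (isOpen_lt continuous_const (continuous_fst.add continuous_snd)).inter
    (isOpen_lt continuous_const continuous_snd)
  have hUs : ContDiffOn ℝ 2 U Ω :=
    (hu.smooth.of_le two_le_infty).comp (g := fun p : ℝ × ℝ => u p.1 p.2)
      (f := fun p : ℝ × ℝ => ((p.1 + p.2) / 2, (p.1 - p.2) / 2)) (by fun_prop)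
      fun p hp => ⟨by linarith [hp.1], by simp only; linarith [hp.2]⟩
  have hUat : ∀ p ∈ Ω, ContDiffAt ℝ 2 U p := fun p hp => hUs.contDiffAt (hΩo.mem_nhds hp)
  have hmix : ∀ p ∈ Ω, fderiv ℝ (fderiv ℝ U) p (1, 0) (0, 1) = Q (p.1 + p.2) * U p := by
    rintro ⟨ξ, η⟩ ⟨h1, h2⟩
    simp only at h1 h2
    have e1 : (ξ + η) / 2 + (ξ - η) / 2 = ξ := by ring
    have e2 : (ξ + η) / 2 - (ξ - η) / 2 = η := by ring
    have e3 : (ξ + η) / 2 + (ξ + η) / 2 = ξ + η := by ring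
    have e := hu.equation ((ξ + η) / 2) ((ξ - η) / 2) (by linarith) (by linarith)
    rw [huU, waveOp_characteristic q (by rw [e1, e2]; exact hUat _ ⟨h1, h2⟩), e1, e2] at e
    have hq' := hq ((ξ + η) / 2) (by linarith)
    rw [e3] at hq'
    simp only [hq']
    linarith
  have hneg : ∀ ξ η, ξ < 0 → 0 < ξ + η → U (ξ, η) = 0 := fun ξ η h1 h2 =>
    hu.causal _ _ (by simp only; linarith) (by simp only; linarith)
  have hzero : ∀ η, 0 < η → U (0, η) = 0 := by
    intro η hη
    have hc : ContinuousAt (fun ξ => U (ξ, η)) 0 :=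
      (hUat (0, η) ⟨by simpa using hη, hη⟩).continuousAt.comp
        (f := fun ξ : ℝ => (ξ, η)) (by fun_prop)
    refine tendsto_nhds_unique (hc.tendsto.mono_left (nhdsWithin_le_nhds (s := Iio 0)))
      (tendsto_const_nhds.congr' ?_)
    filter_upwards [self_mem_nhdsWithin, nhdsWithin_le_nhds (Ioi_mem_nhds (neg_lt_zero.2 hη))]
      with ξ h1 h2
    exact (hneg ξ η h1 (by linarith [mem_Ioi.1 h2])).symm
  have hmem : ∀ {ξ η}, 0 ≤ ξ → 0 < η → (ξ, η) ∈ Ω := fun h1 h2 => ⟨by simp only; linarith, h2⟩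
  have hsnd : ∀ ξ η, 0 ≤ ξ → 0 < η → HasDerivAt (fun η => U (ξ, η))
      (fderiv ℝ U (ξ, η) (0, 1)) η := fun ξ η h1 h2 =>
    hasDerivAt_snd_of_differentiableAt ((hUat _ (hmem h1 h2)).differentiableAt (by simp))
  have hzero' : ∀ η, 0 < η → fderiv ℝ U (0, η) (0, 1) = 0 := by
    intro η hη
    refine (hsnd 0 η le_rfl hη).unique ((hasDerivAt_const η (0 : ℝ)).congr_of_eventuallyEq ?_)
    filter_upwards [Ioi_mem_nhds hη] with s hs using hzero s hs
  have hslice : ∀ ξ η, 0 ≤ ξ → 0 < η → fderiv ℝ U (ξ, η) (0, 1) =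
      ∫ s in (0 : ℝ)..ξ, Q (s + η) * U (s, η) := by
    intro ξ η h1 h2
    rw [intervalIntegral.integral_eq_sub_of_hasDerivAt
      (f := fun s => fderiv ℝ U (s, η) (0, 1)) (fun s hs => ?_), hzero' η h2, sub_zero]
    · refine ContinuousOn.intervalIntegrable fun s hs => ?_
      rw [uIcc_of_le h1] at hs
      have : ContinuousAt (fun s => U (s, η)) s :=
        (hUat _ (hmem hs.1 h2)).continuousAt.comp (f := fun s : ℝ => (s, η)) (by fun_prop)
      have : ContinuousAt (fun s => Q (s + η) * U (s, η)) s :=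
        ContinuousAt.mul (f := fun s => Q (s + η)) (by fun_prop) this
      exact this.continuousWithinAt
    · rw [uIcc_of_le h1] at hs
      rw [← hmix _ (hmem hs.1 h2)]
      exact hasDerivAt_fderiv_snd (hUat _ (hmem hs.1 h2))
  have hint : ∀ ξ η η', 0 ≤ ξ → 0 < η → 0 < η' → U (ξ, η) - U (ξ, η') =
      ∫ σ in η'..η, ∫ s in (0 : ℝ)..ξ, Q (s + σ) * U (s, σ) := by
    intro ξ η η' h1 h2 h3
    have hpos : ∀ σ ∈ uIcc η' η, 0 < σ := fun σ hσ => (lt_min h3 h2).trans_le hσ.1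
    rw [← intervalIntegral.integral_eq_sub_of_hasDerivAt
      (fun σ hσ => hsnd ξ σ h1 (hpos σ hσ))]
    · exact intervalIntegral.integral_congr fun σ hσ => hslice ξ σ h1 (hpos σ hσ)
    · refine ContinuousOn.intervalIntegrable fun σ hσ => ?_
      have h4 : ContinuousAt (fderiv ℝ U) (ξ, σ) :=
        ((hUat _ (hmem h1 (hpos σ hσ))).fderiv_right (m := 1) (by norm_num)).continuousAt
      have h5 : ContinuousAt (fun σ => fderiv ℝ U (ξ, σ)) σ :=
        h4.comp (f := fun σ : ℝ => (ξ, σ)) (by fun_prop)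
      exact (h5.clm_apply continuousAt_const).continuousWithinAt
  -- Beyond η = M the mixed derivative vanishes, so U is constant in η and equals its incoming
  -- limit. The base line is M + 1 because M may be 0, and U is controlled only for η > 0.
  have hfar : ∀ ξ, 0 ≤ ξ → U (ξ, M + 1) = 0 := by
    intro ξ hξ
    have h1 := hu.incoming ξ hξ
    refine tendsto_nhds_unique (tendsto_const_nhds.congr' ?_) h1
    filter_upwards [eventually_ge_atTop ((M + 1 + ξ) / 2)] with s hs
    rw [huU]
    simp only
    rw [show s + (ξ - s) = ξ by ring]
    have h2 := hint ξ (s - (ξ - s)) (M + 1) hξ (by linarith) (by linarith)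
    rw [intervalIntegral.integral_zero_ae] at h2
    · linarith
    · refine .of_forall fun σ hσ => intervalIntegral.integral_zero_ae (.of_forall fun y hy => ?_)
      rw [uIoc_of_le (by linarith)] at hσ
      rw [uIoc_of_le hξ] at hy
      rw [hQ0 _ (by linarith [hy.1, hσ.1]), zero_mul]
  have key : ∀ ξ η, 0 ≤ ξ → 0 < η → U (ξ, η) = 0 := by
    intro ξ η h1 h2
    have hpos : ∀ σ ∈ uIcc (M + 1) η, 0 < σ := fun σ hσ =>
      (lt_min (by linarith) h2).trans_le hσ.1
    have hcomp : IsCompact (Icc 0 ξ ×ˢ uIcc (M + 1) η) := isCompact_Icc.prod isCompact_uIcc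
    obtain ⟨K, hK⟩ := hcomp.exists_bound_of_continuousOn
      (f := fun p : ℝ × ℝ => Q (p.1 + p.2)) (by fun_prop)
    obtain ⟨C, hC⟩ := hcomp.exists_bound_of_continuousOn
      (hUs.continuousOn.mono fun p hp => hmem hp.1.1 (hpos _ hp.2))
    refine eq_zero_of_eq_goursatOp (Q := Q) (M := M + 1) (D := U)
      (L := |η - (M + 1)|) ordConnected_Icc ordConnected_uIcc
      (left_mem_Icc.2 h1) left_mem_uIcc (fun s hs => abs_sub_left_of_mem_uIcc hs)
      (fun t ht s hs => hK (t, s) ⟨ht, hs⟩) (fun t ht s hs => hC (t, s) ⟨ht, hs⟩)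
      (fun t ht s hs => ?_) ξ (right_mem_Icc.2 h1) η right_mem_uIcc
    have := hint t s (M + 1) ht.1 (hpos s hs) (by linarith)
    rw [hfar t ht.1, sub_zero] at this
    exact this
  rw [huU]
  rcases lt_or_ge (x + t) 0 with h | h
  · exact hneg _ _ h (by linarith)
  · exact key _ _ h (by linarith)

theorem IsClassicalSolution.unique {q Q f : ℝ → ℝ} {M : ℝ} (hM : 0 ≤ M)
    (hQc : Continuous Q) (hQ0 : ∀ s, M ≤ s → Q s = 0)
    (hq : ∀ x, 0 < x → Q (x + x) = q x / 4) {u u' : ℝ → ℝ → ℝ}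
    (hu : IsClassicalSolution q f u) (hu' : IsClassicalSolution q f u') {x t : ℝ} (hx : 0 < x)
    (ht : t < x) : u x t = u' x t := by
  have h := hu.sub hu'
  rw [sub_self] at h
  exact sub_eq_zero.1 (h.eq_zero hM hQc hQ0 hq hx ht)

/-! ### The fundamental solution in the sense of distributions -/

/-- Change of variables to characteristic coordinates. -/
theorem integral_comp_characteristic (G : ℝ × ℝ → ℝ) :
    ∫ p : ℝ × ℝ, G (p.1 + p.2, p.1 - p.2) = (1 / 2) * ∫ p, G p := by
  let T : ℝ × ℝ →L[ℝ] ℝ × ℝ := (Matrix.toLin (.finTwoProd ℝ) (.finTwoProd ℝ)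
    !![(1 : ℝ), 1; 1, -1]).toContinuousLinearMap
  have hT : ∀ p : ℝ × ℝ, T p = (p.1 + p.2, p.1 - p.2) := fun p => by
    simp only [T, Matrix.toLin_finTwoProd_toContinuousLinearMap]
    ext <;> simp [sub_eq_add_neg]
  have hdet : T.det = -2 := by
    simp only [T, LinearMap.det_toContinuousLinearMap, LinearMap.det_toLin,
      Matrix.det_fin_two_of]
    norm_num
  have hsurj : T '' univ = univ := by
    refine image_univ_of_surjective fun p => ⟨((p.1 + p.2) / 2, (p.1 - p.2) / 2), ?_⟩
    rw [hT]
    ext <;> simp only <;> ring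
  have hinj : InjOn T univ := fun p _ p' _ h => by
    rw [hT, hT, Prod.mk.injEq] at h
    ext <;> linarith [h.1, h.2]
  have h := integral_image_eq_integral_abs_det_fderiv_smul volume MeasurableSet.univ
    (fun p _ => T.hasFDerivAt.hasFDerivWithinAt) hinj G
  rw [hsurj] at h
  simp only [setIntegral_univ, hdet, abs_neg, Nat.abs_ofNat, smul_eq_mul, hT,
    integral_const_mul] at h
  linarith

/-- Green's identity for the Goursat kernel against a function that vanishes near `η ≤ 0` and far
away. -/
theorem IsGoursatKernel.green {Q : ℝ → ℝ} {M : ℝ} {v : ℝ × ℝ → ℝ} (hv : IsGoursatKernel Q M v)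
    (hQ : ContDiff ℝ 2 Q) {Φ : ℝ × ℝ → ℝ} (hΦ : ContDiff ℝ 2 Φ) {N : ℝ} (hN : 0 ≤ N)
    (h0 : ∀ p : ℝ × ℝ, p.2 ≤ 0 ∨ N ≤ p.1 ∨ N ≤ p.2 → Φ =ᶠ[𝓝 p] 0) :
    (∫ η in (0 : ℝ)..N, (-4 * fderiv ℝ (fderiv ℝ Φ) (0, η) (1, 0) (0, 1) +
        4 * Q (0 + η) * Φ (0, η))) +
      ∫ p in Icc ((0, 0) : ℝ × ℝ) (N, N), v p *
        (-4 * fderiv ℝ (fderiv ℝ Φ) p (1, 0) (0, 1) + 4 * Q (p.1 + p.2) * Φ p) = 0 := by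
  have hQc := hQ.continuous
  have hvs : ContDiff ℝ 2 v := hv.contDiff (n := 2) hQ
  have hΦd : Differentiable ℝ Φ := hΦ.differentiable (by simp)
  have hΦ' : ContDiff ℝ 1 (fderiv ℝ Φ) := hΦ.fderiv_right (m := 1) (by norm_num)
  have hΦ'' : Continuous (fderiv ℝ (fderiv ℝ Φ)) := hΦ'.continuous_fderiv (by simp)
  have hmixc : Continuous fun p => fderiv ℝ (fderiv ℝ Φ) p (1, 0) (0, 1) :=
    (hΦ''.clm_apply continuous_const).clm_apply continuous_const
  have z0 : ∀ p : ℝ × ℝ, p.2 ≤ 0 ∨ N ≤ p.1 ∨ N ≤ p.2 → Φ p = 0 := fun p hp => (h0 p hp).eq_of_nhds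
  have z1 : ∀ p : ℝ × ℝ, p.2 ≤ 0 ∨ N ≤ p.1 ∨ N ≤ p.2 → fderiv ℝ Φ p = 0 := fun p hp => by
    rw [(h0 p hp).fderiv_eq]
    simp
  -- The field (v Φ_η, −v_ξ Φ) has divergence v (Φ_ξη − QΦ). Only the side ξ = 0 contributes to its
  -- flux, and integration by parts there produces ∫ QΦ, which cancels the contribution of δ.
  set f : ℝ × ℝ → ℝ := fun p => v p * fderiv ℝ Φ p (0, 1) with hf
  set g : ℝ × ℝ → ℝ := fun p => -(kernelFst Q M v p * Φ p) with hg
  have hfs : ContDiff ℝ 1 f :=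
    (hvs.of_le one_le_two).mul (hΦ'.clm_apply contDiff_const)
  have hgs : ContDiff ℝ 1 g :=
    ((contDiff_fst (n := 1) (hQ.of_le one_le_two) (hvs.of_le one_le_two)).mul
      (hΦ.of_le one_le_two)).neg
  have hf1 : ∀ p, fderiv ℝ f p (1, 0) = kernelFst Q M v p * fderiv ℝ Φ p (0, 1) +
      v p * fderiv ℝ (fderiv ℝ Φ) p (1, 0) (0, 1) := fun p =>
    (hasDerivAt_fst_of_differentiableAt (hfs.differentiable (by simp) (p.1, p.2))).unique
      ((hv.hasDerivAt_fst hQc p.1 p.2).mul (hasDerivAt_fderiv_snd hΦ.contDiffAt))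
  have hg2 : ∀ p, fderiv ℝ g p (0, 1) = -(Q (p.1 + p.2) * v p * Φ p +
      kernelFst Q M v p * fderiv ℝ Φ p (0, 1)) := fun p =>
    (hasDerivAt_snd_of_differentiableAt (hgs.differentiable (by simp) (p.1, p.2))).unique
      ((hasDerivAt_kernelFst_snd hQc hv.continuous p.1 p.2).mul
        (hasDerivAt_snd_of_differentiableAt (hΦd _))).neg
  have hdiv := integral_divergence_prod_Icc_of_hasFDerivAt_of_le f g (fderiv ℝ f) (fderiv ℝ g)
    (0, 0) (N, N) ⟨hN, hN⟩ hfs.continuous.continuousOn hgs.continuous.continuousOn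
    (fun p _ => (hfs.differentiable (by simp) p).hasFDerivAt)
    (fun p _ => (hgs.differentiable (by simp) p).hasFDerivAt)
    (Continuous.integrableOn_Icc
      (((hfs.continuous_fderiv (by simp)).clm_apply continuous_const).add
      ((hgs.continuous_fderiv (by simp)).clm_apply continuous_const)))
  simp only [hf, hg, z0 (_, N) (.inr (.inr le_rfl)), z0 (_, (0 : ℝ)) (.inl le_rfl),
    z1 (N, _) (.inr (.inl le_rfl)), mul_zero, neg_zero, intervalIntegral.integral_zero,
    zero_apply, sub_zero, zero_add, zero_sub] at hdiv
  simp only [← hf, ← hg] at hdiv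
  have hparts : ∫ η in (0 : ℝ)..N, v (0, η) * fderiv ℝ Φ (0, η) (0, 1) =
      - ∫ η in (0 : ℝ)..N, Q η * Φ (0, η) := by
    have h := intervalIntegral.integral_mul_deriv_eq_deriv_mul (a := 0) (b := N)
      (u := fun η => v (0, η)) (v := fun η => Φ (0, η)) (u' := fun η => kernelSnd Q v (0, η))
      (v' := fun η => fderiv ℝ Φ (0, η) (0, 1)) (fun η _ => hv.hasDerivAt_snd hQc 0 η)
      (fun η _ => hasDerivAt_snd_of_differentiableAt (hΦd _))
      (Continuous.intervalIntegrable ((continuous_kernelSnd hQc hv.continuous).comp (by fun_prop))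
        _ _)
      (Continuous.intervalIntegrable ((hΦ'.continuous.comp (by fun_prop)).clm_apply
        continuous_const) _ _)
    rw [h, z0 (0, N) (.inr (.inr le_rfl)), z0 (0, 0) (.inl le_rfl)]
    simp only [kernelSnd_zero]
    ring
  have hline : ∫ η in (0 : ℝ)..N, fderiv ℝ (fderiv ℝ Φ) (0, η) (1, 0) (0, 1) = 0 := by
    rw [intervalIntegral.integral_eq_sub_of_hasDerivAt (f := fun η => fderiv ℝ Φ (0, η) (1, 0))
      (f' := fun η => fderiv ℝ (fderiv ℝ Φ) (0, η) (1, 0) (0, 1)) (fun η _ => ?_)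
      (Continuous.intervalIntegrable (hmixc.comp (by fun_prop : Continuous fun η : ℝ =>
        ((0 : ℝ), η))) _ _), z1 (0, N) (.inr (.inr le_rfl)), z1 (0, 0) (.inl le_rfl)]
    · simp
    · rw [(hΦ.contDiffAt.isSymmSndFDerivAt (by simp)) (1, 0) (0, 1)]
      have h4 : HasDerivAt (fun η : ℝ => fderiv ℝ Φ (0, η))
          (fderiv ℝ (fderiv ℝ Φ) (0, η) (0, 1)) η :=
        (hΦ'.differentiable (by simp) _).hasFDerivAt.comp_hasDerivAt η
          ((hasDerivAt_const η (0 : ℝ)).prodMk (hasDerivAt_id η))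
      exact ((ContinuousLinearMap.apply ℝ ℝ ((1, 0) : ℝ × ℝ)).hasFDerivAt).comp_hasDerivAt η h4
  have e1 : (∫ η in (0 : ℝ)..N, (-4 * fderiv ℝ (fderiv ℝ Φ) (0, η) (1, 0) (0, 1) +
      4 * Q (0 + η) * Φ (0, η))) = 4 * ∫ η in (0 : ℝ)..N, Q η * Φ (0, η) := by
    have c1 : Continuous fun η : ℝ => fderiv ℝ (fderiv ℝ Φ) (0, η) (1, 0) (0, 1) :=
      hmixc.comp (by fun_prop : Continuous fun η : ℝ => ((0 : ℝ), η))
    have c2 := hΦ.continuous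
    rw [intervalIntegral.integral_add ((c1.const_mul _).intervalIntegrable _ _)
      (Continuous.intervalIntegrable (by fun_prop) _ _), intervalIntegral.integral_const_mul, hline,
      ← intervalIntegral.integral_const_mul]
    simp only [zero_add, mul_assoc, mul_zero]
  have e2 : ∀ p, v p * (-4 * fderiv ℝ (fderiv ℝ Φ) p (1, 0) (0, 1) + 4 * Q (p.1 + p.2) * Φ p) =
      -4 * (fderiv ℝ f p (1, 0) + fderiv ℝ g p (0, 1)) := fun p => by
    rw [hf1, hg2]; ring
  simp only [e1, e2, integral_const_mul]
  rw [hdiv, hparts]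
  ring

/-- The line t = −x becomes ξ = 0 with η = 2x, and the area element also acquires the factor 1/2, so
both terms of the distributional equation reduce to Green's identity with a common factor. -/
theorem isFundamentalSolution_regularPart {q Q : ℝ → ℝ} {M : ℝ} {v : ℝ × ℝ → ℝ}
    (hv : IsGoursatKernel Q M v) (hQ : ContDiff ℝ 2 Q) (hQ0 : ∀ s, M ≤ s → Q s = 0)
    (hq : ∀ x, 0 < x → Q (x + x) = q x / 4) : IsFundamentalSolution q (regularPart v) := by
  have hvc := hv.continuous
  refine ⟨?_, fun x t _ ht => if_pos ht, fun φ hφ hφc hφs => ?_, fun τ hτ => ?_⟩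
  · refine (by fun_prop : Continuous fun p : ℝ × ℝ => v (p.1 + p.2, p.1 - p.2)).continuousOn.congr
      fun p hp => ?_
    exact if_neg (not_lt.2 hp.1)
  · set Φ : ℝ × ℝ → ℝ := fun p => φ ((p.1 + p.2) / 2) ((p.1 - p.2) / 2) with hΦdef
    set c : ℝ × ℝ → ℝ × ℝ := fun p => ((p.1 + p.2) / 2, (p.1 - p.2) / 2) with hc
    have hcc : Continuous c := by fun_prop
    have hφΦ : φ = fun x t => Φ (x + t, x - t) := by
      funext x t
      simp only [hΦdef]
      congr 1 <;> ring
    have hΦ : ContDiff ℝ 2 Φ :=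
      (hφ.of_le two_le_infty).comp (g := fun p : ℝ × ℝ => φ p.1 p.2) (f := c) (by fun_prop)
    have hnear : ∀ p, c p ∉ tsupport (fun p : ℝ × ℝ => φ p.1 p.2) → Φ =ᶠ[𝓝 p] 0 := fun p hp =>
      hcc.continuousAt.eventually (notMem_tsupport_iff_eventuallyEq.1 hp)
    obtain ⟨B, hB⟩ := hφc.isBounded.exists_norm_le
    set N := 2 * |B| + 1 with hN
    have hN0 : 0 < N := by positivity
    have h0 : ∀ p : ℝ × ℝ, p.2 ≤ 0 ∨ N ≤ p.1 ∨ N ≤ p.2 → Φ =ᶠ[𝓝 p] 0 := by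
      intro p hp
      refine hnear p fun hmem => ?_
      have h1 := hφs hmem
      have h2 := hB _ hmem
      have h3 : |(p.1 + p.2) / 2| ≤ |B| := (norm_fst_le (c p)).trans (h2.trans (le_abs_self B))
      have h4 : |(p.1 - p.2) / 2| ≤ |B| := (norm_snd_le (c p)).trans (h2.trans (le_abs_self B))
      rw [abs_le] at h3 h4
      have h5 : (p.1 - p.2) / 2 < (p.1 + p.2) / 2 := h1.2
      rcases hp with hp | hp | hp <;> linarith [h3.1, h3.2, h4.1, h4.2]
    set Ψ : ℝ × ℝ → ℝ := fun p =>
      -4 * fderiv ℝ (fderiv ℝ Φ) p (1, 0) (0, 1) + 4 * Q (p.1 + p.2) * Φ p with hΨ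
    have hΨ0 : ∀ p : ℝ × ℝ, p.2 ≤ 0 ∨ N ≤ p.1 ∨ N ≤ p.2 → Ψ p = 0 := by
      intro p hp
      have h1 : fderiv ℝ Φ =ᶠ[𝓝 p] fun _ => 0 := by
        filter_upwards [(h0 p hp).eventually_nhds] with p' hp'
        rw [EventuallyEq.fderiv_eq hp']
        simp
      simp only [hΨ]
      rw [h1.fderiv_eq, (h0 p hp).eq_of_nhds]
      simp
    have hΨ0' : ∀ p : ℝ × ℝ, p.1 + p.2 ≤ 0 → Ψ p = 0 := by
      intro p hp
      have h2 : Φ =ᶠ[𝓝 p] 0 := hnear p fun hmem => by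
        have h1 : 0 < (p.1 + p.2) / 2 := (hφs hmem).1
        linarith
      have h1 : fderiv ℝ Φ =ᶠ[𝓝 p] fun _ => 0 := by
        filter_upwards [h2.eventually_nhds] with p' hp'
        rw [EventuallyEq.fderiv_eq hp']
        simp
      simp only [hΨ]
      rw [h1.fderiv_eq, h2.eq_of_nhds]
      simp
    have hwave : ∀ x t, 0 < x → waveOp q φ x t = Ψ (x + t, x - t) := by
      intro x t hx
      rw [hφΦ, waveOp_characteristic q hΦ.contDiffAt]
      simp only [hΨ, show x + t + (x - t) = x + x by ring, hq x hx]
      ring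
    have hfirst : ∫ x in Ioi (0 : ℝ), waveOp q φ x (-x) =
        (1 / 2) * ∫ η in (0 : ℝ)..N, Ψ (0, η) := by
      have e1 : ∫ x in Ioi (0 : ℝ), waveOp q φ x (-x) = ∫ x in Ioi (0 : ℝ), Ψ (0, 2 * x) := by
        refine setIntegral_congr_fun measurableSet_Ioi fun x hx => ?_
        rw [hwave x (-x) hx]
        congr 2 <;> ring
      rw [e1, integral_comp_mul_left_Ioi (fun η => Ψ (0, η)) 0 two_pos, mul_zero,
        intervalIntegral.integral_of_le hN0.le, smul_eq_mul, one_div]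
      congr 1
      refine setIntegral_eq_of_subset_of_forall_sdiff_eq_zero measurableSet_Ioi
        Ioc_subset_Ioi_self fun η hη => hΨ0 _ (.inr (.inr ?_))
      by_contra hlt
      exact hη.2 ⟨hη.1, (not_le.1 hlt).le⟩
    have hsecond : ∫ p in domain, regularPart v p.1 p.2 * waveOp q φ p.1 p.2 =
        (1 / 2) * ∫ p in Icc ((0, 0) : ℝ × ℝ) (N, N), v p * Ψ p := by
      set G : ℝ × ℝ → ℝ := fun p => if p.1 < 0 then 0 else v p * Ψ p with hG
      have e1 : ∫ p in domain, regularPart v p.1 p.2 * waveOp q φ p.1 p.2 =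
          ∫ p in domain, G (p.1 + p.2, p.1 - p.2) := by
        refine setIntegral_congr_fun isOpen_domain.measurableSet fun p hp => ?_
        simp only [hG]
        rw [hwave _ _ hp.1, regularPart]
        by_cases h : p.1 + p.2 < 0
        · rw [if_pos h, if_pos (by linarith), zero_mul]
        · rw [if_neg h, if_neg (by linarith)]
      have e2 : ∫ p in domain, G (p.1 + p.2, p.1 - p.2) = ∫ p : ℝ × ℝ, G (p.1 + p.2, p.1 - p.2) := by
        refine setIntegral_eq_integral_of_forall_compl_eq_zero fun p hp => ?_
        have hz : Ψ (p.1 + p.2, p.1 - p.2) = 0 := by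
          by_cases h : p.1 - p.2 ≤ 0
          · exact hΨ0 _ (.inl h)
          · refine hΨ0' _ ?_
            simp only
            by_contra h'
            exact hp ⟨by linarith, by linarith⟩
        simp [hG, hz]
      have e3 : ∫ p in Icc ((0, 0) : ℝ × ℝ) (N, N), v p * Ψ p = ∫ p, G p := by
        rw [← setIntegral_eq_integral_of_forall_compl_eq_zero (f := G) (s := Icc ((0, 0) : ℝ × ℝ) (N, N))]
        · refine setIntegral_congr_fun measurableSet_Icc fun p hp => ?_
          simp only [hG]
          rw [if_neg (not_lt.2 hp.1.1)]
        · intro p hp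
          simp only [hG]
          split_ifs with h
          · rfl
          · rw [hΨ0 p, mul_zero]
            by_contra! hlt
            exact hp ⟨⟨not_lt.1 h, hlt.1.le⟩, ⟨hlt.2.1.le, hlt.2.2.le⟩⟩
      rw [e1, e2, e3, integral_comp_characteristic]
    have hgreen := hv.green hQ hΦ hN0.le h0
    rw [hfirst, hsecond, ← mul_add]
    simp only [hΨ]
    rw [hgreen, mul_zero]
  · refine tendsto_const_nhds.congr' ?_
    filter_upwards [eventually_ge_atTop ((M + τ) / 2)] with s hs
    rw [regularPart, if_neg (by linarith), hv.eq_zero hQ0 (by linarith) (by linarith)]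

/-! ### The quadratic identity -/

/-- The quadratic identity that links the kernel of the control operator to the reflection
kernel. -/
theorem IsGoursatKernel.quadratic_identity {Q : ℝ → ℝ} {M : ℝ} {v : ℝ × ℝ → ℝ}
    (hv : IsGoursatKernel Q M v) (hM : 0 ≤ M) (hQ : ContDiff ℝ 2 Q)
    (hQ0 : ∀ s, M ≤ s → Q s = 0) {α β : ℝ} (hα : 0 ≤ α) (hβ : 0 ≤ β) :
    v (β, α) + ∫ y in (0 : ℝ)..M, v (β + y, α + y) * v (y, α + β + y) = v (M, α) := by
  have hQc := hQ.continuous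
  have hvc := hv.continuous
  have hvs : ContDiff ℝ 2 v := hv.contDiff (n := 2) hQ
  have c₁ := continuous_kernelFst (M := M) hQc hvc
  have c₂ := continuous_kernelSnd hQc hvc
  have s₂ : ContDiff ℝ 1 (kernelSnd Q v) :=
    contDiff_snd (n := 1) (hQ.of_le one_le_two) (hvs.of_le one_le_two)
  set v₂₂ : ℝ × ℝ → ℝ := fun p => fderiv ℝ (kernelSnd Q v) p (0, 1) with hv₂₂
  have c₂₂ : Continuous v₂₂ := (s₂.continuous_fderiv (by simp)).clm_apply continuous_const
  have dv : ∀ {a b : ℝ → ℝ} {a' b' s : ℝ}, HasDerivAt a a' s → HasDerivAt b b' s →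
      HasDerivAt (fun s => v (a s, b s))
        (kernelFst Q M v (a s, b s) * a' + kernelSnd Q v (a s, b s) * b') s := fun ha hb =>
    hasDerivAt_comp_of_partial (fun x y => hv.hasDerivAt_fst hQc x y)
      (fun x y => hv.hasDerivAt_snd hQc x y) c₁ c₂ ha hb
  have dv₂ : ∀ {a b : ℝ → ℝ} {a' b' s : ℝ}, HasDerivAt a a' s → HasDerivAt b b' s →
      HasDerivAt (fun s => kernelSnd Q v (a s, b s))
        (Q (a s + b s) * v (a s, b s) * a' + v₂₂ (a s, b s) * b') s := fun ha hb =>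
    hasDerivAt_comp_of_partial (v₁ := fun p => Q (p.1 + p.2) * v p)
      (fun x y => hasDerivAt_kernelSnd_fst hQc hvc x y)
      (fun x y => hasDerivAt_snd_of_differentiableAt (s₂.differentiable (by simp) _))
      (by fun_prop) c₂₂ ha hb
  have idd : ∀ c s : ℝ, HasDerivAt (fun s => s + c) 1 s := fun c s => (hasDerivAt_id s).add_const c
  have cdd : ∀ c s : ℝ, HasDerivAt (fun s => c + s) 1 s := fun c s => (hasDerivAt_id s).const_add c
  have icd : ∀ c d s : ℝ, HasDerivAt (fun s => s + c + d) 1 s := fun c d s =>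
    (idd c s).add_const d
  have cid : ∀ c d s : ℝ, HasDerivAt (fun s => c + s + d) 1 s := fun c d s =>
    (cdd c s).add_const d
  set P : ℝ → ℝ → ℝ := fun α β =>
    v (β, α) + ∫ y in (0 : ℝ)..M, v (β + y, α + y) * v (y, α + β + y) with hP
  set P₁ : ℝ → ℝ → ℝ := fun α β => kernelSnd Q v (β, α) + ∫ y in (0 : ℝ)..M,
    (kernelSnd Q v (β + y, α + y) * v (y, α + β + y) +
      v (β + y, α + y) * kernelSnd Q v (y, α + β + y)) with hP₁
  have dP : ∀ α β, HasDerivAt (fun α => P α β) (P₁ α β) α := by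
    intro α β
    refine (hv.hasDerivAt_snd hQc β α).add (hasDerivAt_intervalIntegral_param
      (F := fun α y => v (β + y, α + y) * v (y, α + β + y))
      (F' := fun α y => kernelSnd Q v (β + y, α + y) * v (y, α + β + y) +
        v (β + y, α + y) * kernelSnd Q v (y, α + β + y)) (by fun_prop) (by fun_prop)
      (fun α y => ?_) 0 M α)
    refine ((dv (hasDerivAt_const α (β + y)) (idd y α)).mul
      (dv (hasDerivAt_const α y) (icd β y α))).congr_deriv ?_
    ring
  have dP₁ : ∀ α β, 0 ≤ α → 0 ≤ β → HasDerivAt (fun β => P₁ α β) 0 β := by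
    intro α β hα hβ
    have h1 := (dv₂ (hasDerivAt_id β) (hasDerivAt_const β α)).add
      (hasDerivAt_intervalIntegral_param
      (F := fun β y => kernelSnd Q v (β + y, α + y) * v (y, α + β + y) +
        v (β + y, α + y) * kernelSnd Q v (y, α + β + y))
      (F' := fun β y => (Q (β + y + (α + y)) * v (β + y, α + y) * v (y, α + β + y) +
        kernelSnd Q v (β + y, α + y) * kernelSnd Q v (y, α + β + y)) +
        (kernelFst Q M v (β + y, α + y) * kernelSnd Q v (y, α + β + y) +
        v (β + y, α + y) * v₂₂ (y, α + β + y))) (by fun_prop) (by fun_prop)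
      (fun β y => ?_) 0 M β)
    · refine h1.congr_deriv ?_
      -- The β-derivative of the integrand of P₁ is the y-derivative of v(β + y, α + y) v_η(y, α + β
      -- + y). It vanishes at y = M and equals v(β, α) Q(α + β) at y = 0.
      have h2 := intervalIntegral.integral_eq_sub_of_hasDerivAt (a := 0) (b := M)
        (fun y _ => (dv (cdd β y) (cdd α y)).mul (dv₂ (hasDerivAt_id y) (cdd (α + β) y)))
        (Continuous.intervalIntegrable (by simp only [id]; fun_prop) _ _)
      simp only [Pi.mul_apply, id, add_zero, kernelSnd_zero,
        hv.eq_zero hQ0 (by linarith : 0 ≤ β + M) (by linarith : M ≤ α + M), zero_mul] at h2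
      have h3 : (∫ y in (0 : ℝ)..M, ((Q (β + y + (α + y)) * v (β + y, α + y) * v (y, α + β + y) +
          kernelSnd Q v (β + y, α + y) * kernelSnd Q v (y, α + β + y)) +
          (kernelFst Q M v (β + y, α + y) * kernelSnd Q v (y, α + β + y) +
          v (β + y, α + y) * v₂₂ (y, α + β + y)))) = 0 - v (β, α) * Q (α + β) := by
        rw [← h2]
        refine intervalIntegral.integral_congr fun y _ => ?_
        simp only [show y + (α + β + y) = β + y + (α + y) by ring]
        ring
      rw [h3]
      simp only [id, add_comm β α]
      ring
    · refine (((dv₂ (idd y β) (hasDerivAt_const β (α + y))).mul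
        (dv (hasDerivAt_const β y) (cid α y β))).add
        ((dv (idd y β) (hasDerivAt_const β (α + y))).mul
          (dv₂ (hasDerivAt_const β y) (cid α y β)))).congr_deriv ?_
      ring
  have far : ∀ α β, 0 ≤ α → 0 ≤ β → M ≤ α + β → P α β = v (M, α) := by
    intro α β hα hβ h
    simp only [hP]
    rw [hv.eq_reflected hQc hQ0 hM hβ hα (by linarith), intervalIntegral.integral_zero_ae, add_zero]
    refine .of_forall fun y hy => ?_
    rw [uIoc_of_le hM] at hy
    rw [hv.eq_zero hQ0 hy.1.le (by linarith [hy.1]), mul_zero]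
  -- At β = M the far-field formula holds for all nearby positive α and can be differentiated. As P₁
  -- does not depend on β ≥ 0, its value is then known everywhere.
  have hP₁M : ∀ α, 0 < α → P₁ α M = kernelSnd Q v (M, α) := by
    intro α hα
    refine (dP α M).unique ((hv.hasDerivAt_snd hQc M α).congr_of_eventuallyEq ?_)
    filter_upwards [Ioi_mem_nhds hα] with s hs
    exact far s M (le_of_lt hs) hM (by linarith [mem_Ioi.1 hs])
  have hP₁β : ∀ α, 0 < α → P₁ α β = kernelSnd Q v (M, α) := by
    intro α hα
    rw [← hP₁M α hα]
    have h := intervalIntegral.integral_eq_sub_of_hasDerivAt (a := M) (b := β)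
      (f := fun β => P₁ α β) (f' := fun _ => 0)
      (fun s hs => dP₁ α s hα.le ((le_min hM hβ).trans hs.1))
      (continuous_const.intervalIntegrable _ _)
    rw [intervalIntegral.integral_zero] at h
    linarith
  have hcP₁ : Continuous fun α => P₁ α β := by
    refine Continuous.add (by fun_prop) ?_
    exact intervalIntegral.continuous_parametric_intervalIntegral_of_continuous'
      (f := fun α y => kernelSnd Q v (β + y, α + y) * v (y, α + β + y) +
      v (β + y, α + y) * kernelSnd Q v (y, α + β + y)) (by fun_prop) 0 M
  -- P(s, β) − v(M, s) has zero derivative for s > 0 and vanishes at s = α + M, which lies in the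
  -- far field.
  have h := intervalIntegral.integral_eq_sub_of_hasDerivAt (a := α) (b := α + M)
    (fun s _ => (dP s β).sub (hv.hasDerivAt_snd hQc M s))
    (Continuous.intervalIntegrable (hcP₁.sub (c₂.comp (by fun_prop : Continuous fun s => (M, s))))
      _ _)
  rw [intervalIntegral.integral_zero_ae] at h
  · simp only [Pi.sub_apply, far (α + M) β (by linarith) hβ (by linarith), sub_self] at h
    linarith
  · refine .of_forall fun s hs => ?_
    rw [uIoc_of_le (by linarith)] at hs
    exact sub_eq_zero.2 (hP₁β s (by linarith [hs.1]))

/-! ### Integral operators with truncated kernels -/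

/-- A bounded measurable kernel that vanishes when one of its arguments exceeds `b`. -/
structure IsTruncatedKernel (b B : ℝ) (k : ℝ → ℝ → ℝ) : Prop where
  measurable : Measurable (Function.uncurry k)
  bound : ∀ x s, |k x s| ≤ B
  fst_eq_zero : ∀ x s, b < x → k x s = 0
  snd_eq_zero : ∀ x s, b < s → k x s = 0

theorem halfLine_restrict_Iic (b : ℝ) : halfLine.restrict (Iic b) = volume.restrict (Ioc 0 b) := by
  rw [Measure.restrict_restrict measurableSet_Iic, inter_comm, Ioi_inter_Iic]

theorem eLpNorm_truncated_le {b C : ℝ} {g : ℝ → ℝ} (hC : ∀ x, |g x| ≤ C)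
    (h0 : ∀ x, b < x → g x = 0) :
    eLpNorm g 2 halfLine ≤
      (volume.restrict (Ioc 0 b) univ) ^ (2 : ENNReal).toReal⁻¹ * ENNReal.ofReal C := by
  have h1 : (Iic b).indicator g = g := indicator_eq_self.2 fun x hx => by
    by_contra h
    exact hx (h0 x (not_le.1 h))
  rw [← h1, eLpNorm_indicator_eq_eLpNorm_restrict measurableSet_Iic, halfLine_restrict_Iic]
  exact eLpNorm_le_of_ae_bound (.of_forall hC)

theorem memLp_truncated {b C : ℝ} {g : ℝ → ℝ} (hg : AEStronglyMeasurable g halfLine)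
    (hC : ∀ x, |g x| ≤ C) (h0 : ∀ x, b < x → g x = 0) : MemLp g 2 halfLine := by
  refine ⟨hg, (eLpNorm_truncated_le hC h0).trans_lt (ENNReal.mul_lt_top ?_ ENNReal.ofReal_lt_top)⟩
  exact ENNReal.rpow_lt_top_of_nonneg (by positivity) (measure_ne_top _ _)

theorem norm_toLp_truncated_le {b C : ℝ} {g : ℝ → ℝ} (hg : MemLp g 2 halfLine)
    (hC : ∀ x, |g x| ≤ C) (h0 : ∀ x, b < x → g x = 0) :
    ‖hg.toLp g‖ ≤ ((volume.restrict (Ioc 0 b) univ) ^ (2 : ENNReal).toReal⁻¹).toReal * C := by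
  have hC0 : 0 ≤ C := (abs_nonneg _).trans (hC 0)
  rw [Lp.norm_toLp]
  refine (ENNReal.toReal_mono ?_ (eLpNorm_truncated_le hC h0)).trans_eq ?_
  · exact (ENNReal.mul_lt_top (ENNReal.rpow_lt_top_of_nonneg (by positivity) (measure_ne_top _ _))
      ENNReal.ofReal_lt_top).ne
  · rw [ENNReal.toReal_mul, ENNReal.toReal_ofReal hC0]

namespace IsTruncatedKernel

variable {b B : ℝ} {k l : ℝ → ℝ → ℝ}

theorem swap (hk : IsTruncatedKernel b B k) : IsTruncatedKernel b B fun x s => k s x :=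
  ⟨hk.measurable.comp measurable_swap, fun x s => hk.bound s x,
    fun x s h => hk.snd_eq_zero s x h, fun x s h => hk.fst_eq_zero s x h⟩

theorem memLp (hk : IsTruncatedKernel b B k) (x : ℝ) : MemLp (k x) 2 halfLine :=
  memLp_truncated (hk.measurable.comp measurable_prodMk_left).aestronglyMeasurable (hk.bound x)
    (hk.snd_eq_zero x)

theorem integrable_mul (hk : IsTruncatedKernel b B k) (x : ℝ) {f : ℝ → ℝ}
    (hf : MemLp f 2 halfLine) : Integrable (fun s => k x s * f s) halfLine :=
  (hk.memLp x).integrable_mul hf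

theorem inner_toLp (hk : IsTruncatedKernel b B k) (x : ℝ) (f : L2) :
    inner ℝ ((hk.memLp x).toLp (k x)) f = ∫ s, k x s * f s ∂halfLine := by
  rw [L2.inner_def]
  refine integral_congr_ae ?_
  filter_upwards [(hk.memLp x).coeFn_toLp] with s hs
  rw [hs]
  simp [mul_comm]

theorem abs_inner_toLp_le (hk : IsTruncatedKernel b B k) (x : ℝ) (f : L2) :
    |inner ℝ ((hk.memLp x).toLp (k x)) f| ≤
      ((volume.restrict (Ioc 0 b) univ) ^ (2 : ENNReal).toReal⁻¹).toReal * B * ‖f‖ :=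
  (abs_real_inner_le_norm _ _).trans (mul_le_mul_of_nonneg_right
    (norm_toLp_truncated_le _ (hk.bound x) (hk.snd_eq_zero x)) (norm_nonneg _))

theorem inner_toLp_eq_zero (hk : IsTruncatedKernel b B k) {x : ℝ} (hx : b < x) (f : L2) :
    inner ℝ ((hk.memLp x).toLp (k x)) f = 0 := by
  rw [hk.inner_toLp]
  simp [hk.fst_eq_zero x _ hx]

/-- Pairing with the sections of the kernel gives a bounded function vanishing beyond b; this is
what defines the operator pointwise. -/
theorem memLp_inner_toLp (hk : IsTruncatedKernel b B k) (f : L2) :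
    MemLp (fun x => inner ℝ ((hk.memLp x).toLp (k x)) f) 2 halfLine := by
  refine memLp_truncated ?_ (fun x => hk.abs_inner_toLp_le x f)
    fun x hx => hk.inner_toLp_eq_zero hx f
  simp only [hk.inner_toLp]
  refine StronglyMeasurable.aestronglyMeasurable ?_
  refine StronglyMeasurable.integral_prod_right (f := fun x s => k x s * f s) ?_
  exact (hk.measurable.stronglyMeasurable).mul
    ((Lp.stronglyMeasurable f).comp_measurable measurable_snd)

/-- The integral operator on `L₂(0,∞)` with a truncated kernel. -/
noncomputable def operator (hk : IsTruncatedKernel b B k) : L2 →L[ℝ] L2 :=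
  LinearMap.mkContinuous
    { toFun := fun f => (hk.memLp_inner_toLp f).toLp _
      map_add' := fun f g => by
        rw [← MemLp.toLp_add]
        simp only [inner_add_right]
        rfl
      map_smul' := fun c f => by
        rw [RingHom.id_apply, ← MemLp.toLp_const_smul]
        simp only [inner_smul_right]
        rfl }
    (((volume.restrict (Ioc 0 b) univ) ^ (2 : ENNReal).toReal⁻¹).toReal *
      (((volume.restrict (Ioc 0 b) univ) ^ (2 : ENNReal).toReal⁻¹).toReal * B))
    fun f => (norm_toLp_truncated_le (hk.memLp_inner_toLp f) (fun x => hk.abs_inner_toLp_le x f)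
      fun x hx => hk.inner_toLp_eq_zero hx f).trans_eq (by ring)

theorem operator_apply (hk : IsTruncatedKernel b B k) (f : L2) :
    hk.operator f =ᵐ[halfLine] fun x => ∫ s, k x s * f s ∂halfLine := by
  refine (MemLp.coeFn_toLp (hk.memLp_inner_toLp f)).trans (.of_forall fun x => ?_)
  exact hk.inner_toLp x f

theorem integrable_indicator {f : ℝ → ℝ} (hf : MemLp f 2 halfLine) (b : ℝ) :
    Integrable ((Iic b).indicator f) halfLine := by
  rw [integrable_indicator_iff measurableSet_Iic, IntegrableOn]
  have h := hf.restrict (Iic b)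
  rw [halfLine_restrict_Iic] at *
  exact h.integrable one_le_two

/-- On (0, b] an L₂ function is integrable, so a bounded kernel truncated in both variables gives
the absolute integrability needed for Fubini in adjoints and composites. -/
theorem integrable_prod (hk : IsTruncatedKernel b B k) {f g : ℝ → ℝ} (hf : MemLp f 2 halfLine)
    (hg : MemLp g 2 halfLine) :
    Integrable (fun p : ℝ × ℝ => k p.1 p.2 * (g p.1 * f p.2)) (halfLine.prod halfLine) := by
  have h := ((integrable_indicator hg b).mul_prod (integrable_indicator hf b)).bdd_mul
    (f := Function.uncurry k) (c := B)
    hk.measurable.aestronglyMeasurable (.of_forall fun p => hk.bound p.1 p.2)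
  refine h.congr (.of_forall fun p => ?_)
  simp only [Function.uncurry]
  by_cases h1 : b < p.1
  · simp [hk.fst_eq_zero _ _ h1]
  · by_cases h2 : b < p.2
    · simp [hk.snd_eq_zero _ _ h2]
    · rw [indicator_of_mem (mem_Iic.2 (not_lt.1 h1)), indicator_of_mem (mem_Iic.2 (not_lt.1 h2))]

theorem adjoint_operator (hk : IsTruncatedKernel b B k) :
    ContinuousLinearMap.adjoint hk.operator = hk.swap.operator := by
  symm
  rw [ContinuousLinearMap.eq_adjoint_iff]
  intro f g
  rw [L2.inner_def, L2.inner_def]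
  have hf := Lp.memLp f
  have hg := Lp.memLp g
  have e1 : ∫ x, inner ℝ (hk.swap.operator f x) (g x) ∂halfLine =
      ∫ x, ∫ s, k s x * (f s * g x) ∂halfLine ∂halfLine := by
    refine integral_congr_ae ?_
    filter_upwards [hk.swap.operator_apply f] with x hx
    rw [hx, RCLike.inner_apply, conj_trivial, ← integral_const_mul]
    congr 1; funext s; ring
  have e2 : ∫ x, inner ℝ (f x) (hk.operator g x) ∂halfLine =
      ∫ x, ∫ s, k x s * (f x * g s) ∂halfLine ∂halfLine := by
    refine integral_congr_ae ?_
    filter_upwards [hk.operator_apply g] with x hx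
    rw [hx, RCLike.inner_apply, conj_trivial, ← integral_mul_const]
    congr 1; funext s; ring
  rw [e1, e2]
  exact (integral_integral_swap (hk.integrable_prod hg hf)).symm

theorem integrable_comp (hk : IsTruncatedKernel b B k) (hl : IsTruncatedKernel b B l) (x : ℝ)
    {f : ℝ → ℝ} (hf : MemLp f 2 halfLine) :
    Integrable (fun p : ℝ × ℝ => k x p.1 * l p.1 p.2 * f p.2) (halfLine.prod halfLine) := by
  refine (hl.integrable_prod hf (hk.memLp x)).congr (.of_forall fun p => ?_)
  simp only
  ring

theorem operator_comp_apply (hk : IsTruncatedKernel b B k) (hl : IsTruncatedKernel b B l)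
    (f : L2) : hk.operator (hl.operator f) =ᵐ[halfLine]
      fun x => ∫ s, (∫ y, k x y * l y s ∂halfLine) * f s ∂halfLine := by
  refine (hk.operator_apply _).trans (.of_forall fun x => ?_)
  have e1 : ∫ y, k x y * hl.operator f y ∂halfLine =
      ∫ y, ∫ s, k x y * l y s * f s ∂halfLine ∂halfLine := by
    refine integral_congr_ae ?_
    filter_upwards [hl.operator_apply f] with y hy
    rw [hy, ← integral_const_mul]
    simp only [mul_assoc]
  simp only [e1]
  rw [integral_integral_swap (hk.integrable_comp hl x (Lp.memLp f))]
  simp only [integral_mul_const]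

theorem integrable_comp_mul (hk : IsTruncatedKernel b B k) (hl : IsTruncatedKernel b B l) (x : ℝ)
    {f : ℝ → ℝ} (hf : MemLp f 2 halfLine) :
    Integrable (fun s => (∫ y, k x y * l y s ∂halfLine) * f s) halfLine := by
  refine (hk.integrable_comp hl x hf).integral_prod_right.congr (.of_forall fun s => ?_)
  exact integral_mul_const (f s) fun y => k x y * l y s

end IsTruncatedKernel

/-- A quadratic identity between kernels gives the operator identity `(1 + K)* (1 + K) = 1 + R`. -/
theorem connectingOperator_eq {b B b' B' : ℝ} {k r : ℝ → ℝ → ℝ} (hk : IsTruncatedKernel b B k)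
    (hr : IsTruncatedKernel b' B' r)
    (h : ∀ x s, 0 < x → 0 < s → x ≠ s →
      k s x + k x s + ∫ y, k y x * k y s ∂halfLine = r x s) :
    connectingOperator (ContinuousLinearMap.id ℝ L2 + hk.operator) =
      ContinuousLinearMap.id ℝ L2 + hr.operator := by
  have key : ∀ f : L2, hk.swap.operator f + hk.operator f + hk.swap.operator (hk.operator f) =
      hr.operator f := by
    intro f
    have hf := Lp.memLp f
    refine Lp.ext ?_
    filter_upwards [Lp.coeFn_add (hk.swap.operator f + hk.operator f)
      (hk.swap.operator (hk.operator f)), Lp.coeFn_add (hk.swap.operator f) (hk.operator f),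
      hk.swap.operator_apply f, hk.operator_apply f, hk.swap.operator_comp_apply hk f,
      hr.operator_apply f, ae_restrict_mem measurableSet_Ioi] with x h1 h2 h3 h4 h5 h6 hx
    have i12 : Integrable (fun s => k s x * f s + k x s * f s) halfLine :=
      (hk.swap.integrable_mul x hf).add (hk.integrable_mul x hf)
    rw [h1, Pi.add_apply, h2, Pi.add_apply, h3, h4, h5, h6,
      ← integral_add (hk.swap.integrable_mul x hf) (hk.integrable_mul x hf),
      ← integral_add i12 (hk.swap.integrable_comp_mul hk x hf)]
    refine integral_congr_ae ?_
    -- The kernel identity is assumed only off the diagonal; for fixed x the point s = x is null.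
    filter_upwards [ae_restrict_mem measurableSet_Ioi,
      ae_restrict_of_ae (Measure.ae_ne volume x)] with s hs hne
    rw [← h x s hx hs (Ne.symm hne)]
    ring
  ext1 f
  rw [connectingOperator, map_add, hk.adjoint_operator, ContinuousLinearMap.adjoint_id]
  simp only [ContinuousLinearMap.comp_apply, add_apply, ContinuousLinearMap.id_apply, map_add,
    ← key]
  abel

/-! ### The control and response operators -/

/-- The kernel of `W - 1`, where `W` is the control operator. -/
noncomputable def controlKernel (v : ℝ × ℝ → ℝ) (M x s : ℝ) : ℝ :=
  if 0 ≤ s ∧ s ≤ x ∧ x ≤ M then v (x - s, x + s) else 0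

/-- The kernel of the response operator. -/
noncomputable def responseKernel (v : ℝ × ℝ → ℝ) (M x s : ℝ) : ℝ :=
  if 0 ≤ x ∧ 0 ≤ s ∧ x ≤ M ∧ s ≤ M then v (M, x + s) else 0

theorem exists_isTruncatedKernel_controlKernel {v : ℝ × ℝ → ℝ} (hv : Continuous v) (M : ℝ) :
    ∃ B, IsTruncatedKernel M B (controlKernel v M) := by
  obtain ⟨C, hC⟩ := ((isCompact_Icc (a := 0) (b := M)).prod
    (isCompact_Icc (a := 0) (b := M + M))).exists_bound_of_continuousOn hv.continuousOn
  refine ⟨max C 0, ?_, fun x s => ?_, fun x s h => ?_, fun x s h => ?_⟩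
  · refine Measurable.ite (p := fun p : ℝ × ℝ => 0 ≤ p.2 ∧ p.2 ≤ p.1 ∧ p.1 ≤ M) ?_
      (by fun_prop : Continuous fun p : ℝ × ℝ => v (p.1 - p.2, p.1 + p.2)).measurable
      measurable_const
    exact (measurableSet_le measurable_const measurable_snd).inter
      ((measurableSet_le measurable_snd measurable_fst).inter
        (measurableSet_le measurable_fst measurable_const))
  · rw [controlKernel]
    split_ifs with h
    · refine (hC (x - s, x + s) ⟨⟨?_, ?_⟩, ?_, ?_⟩).trans (le_max_left _ _) <;>
        simp only <;> linarith [h.1, h.2.1, h.2.2]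
    · simp
  · exact if_neg fun h' => by linarith [h'.2.2]
  · exact if_neg fun h' => by linarith [h'.2.2, h'.2.1]

theorem exists_isTruncatedKernel_responseKernel {v : ℝ × ℝ → ℝ} (hv : Continuous v) (M : ℝ) :
    ∃ B, IsTruncatedKernel M B (responseKernel v M) := by
  obtain ⟨C, hC⟩ := ((isCompact_singleton (x := M)).prod
    (isCompact_Icc (a := 0) (b := M + M))).exists_bound_of_continuousOn hv.continuousOn
  refine ⟨max C 0, ?_, fun x s => ?_, fun x s h => ?_, fun x s h => ?_⟩
  · refine Measurable.ite (p := fun p : ℝ × ℝ => 0 ≤ p.1 ∧ 0 ≤ p.2 ∧ p.1 ≤ M ∧ p.2 ≤ M) ?_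
      (by fun_prop : Continuous fun p : ℝ × ℝ => v (M, p.1 + p.2)).measurable measurable_const
    exact (measurableSet_le measurable_const measurable_fst).inter
      ((measurableSet_le measurable_const measurable_snd).inter
      ((measurableSet_le measurable_fst measurable_const).inter
        (measurableSet_le measurable_snd measurable_const)))
  · rw [responseKernel]
    split_ifs with h
    · refine (hC (M, x + s) ⟨rfl, ?_, ?_⟩).trans (le_max_left _ _) <;>
        simp only <;> linarith [h.1, h.2.1, h.2.2.1, h.2.2.2]
    · simp
  · exact if_neg fun h' => by linarith [h'.2.2.1]
  · exact if_neg fun h' => by linarith [h'.2.2.2]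

namespace IsGoursatKernel

variable {Q : ℝ → ℝ} {M : ℝ} {v : ℝ × ℝ → ℝ}

theorem controlKernel_eq (hv : IsGoursatKernel Q M v) (hQ0 : ∀ s, M ≤ s → Q s = 0) {x s : ℝ}
    (hs : 0 ≤ s) (hsx : s ≤ x) : controlKernel v M x s = v (x - s, x + s) := by
  rw [controlKernel]
  split_ifs with h
  · rfl
  · refine (hv.eq_zero hQ0 (by linarith) ?_).symm
    by_contra h'
    exact h ⟨hs, hsx, by linarith⟩

theorem responseKernel_eq (hv : IsGoursatKernel Q M v) (hM : 0 ≤ M)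
    (hQ0 : ∀ s, M ≤ s → Q s = 0) {x s : ℝ} (hx : 0 ≤ x) (hs : 0 ≤ s) :
    responseKernel v M x s = v (M, x + s) := by
  rw [responseKernel]
  split_ifs with h
  · rfl
  · refine (hv.eq_zero hQ0 hM ?_).symm
    by_contra h'
    exact h ⟨hx, hs, by linarith, by linarith⟩

theorem kernel_identity_of_lt (hv : IsGoursatKernel Q M v) (hM : 0 ≤ M) (hQ : ContDiff ℝ 2 Q)
    (hQ0 : ∀ s, M ≤ s → Q s = 0) {x s : ℝ} (hs : 0 < s) (h : s < x) :
    controlKernel v M x s + ∫ y, controlKernel v M y x * controlKernel v M y s ∂halfLine =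
      v (M, x + s) := by
  have hx := hs.trans h
  -- The product lives on x ≤ y ≤ M. Enlarging the range to [x, x + M] lets the shift by x turn it
  -- into the interval [0, M] of the quadratic identity.
  have e1 : ∫ y, controlKernel v M y x * controlKernel v M y s ∂halfLine =
      ∫ y in Ioc (x + 0) (x + M), controlKernel v M y x * controlKernel v M y s := by
    rw [← integral_Icc_eq_integral_Ioc]
    refine setIntegral_eq_of_subset_of_forall_sdiff_eq_zero measurableSet_Ioi
      (fun y hy => hx.trans_le (by linarith [hy.1])) fun y hy => ?_
    rw [controlKernel, if_neg fun h' => hy.2 ⟨by linarith [h'.2.1], by linarith [h'.2.2]⟩, zero_mul]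
  rw [e1, ← intervalIntegral.integral_of_le (by linarith),
    ← intervalIntegral.integral_comp_add_left
      (fun y => controlKernel v M y x * controlKernel v M y s) x,
    hv.controlKernel_eq hQ0 hs.le h.le,
    ← hv.quadratic_identity hM hQ hQ0 (by linarith : 0 ≤ x + s) (by linarith : 0 ≤ x - s)]
  congr 1
  refine intervalIntegral.integral_congr fun y hy => ?_
  rw [uIcc_of_le hM] at hy
  rw [hv.controlKernel_eq hQ0 hx.le (by linarith [hy.1]),
    hv.controlKernel_eq hQ0 hs.le (by linarith [hy.1]), mul_comm]
  ring_nf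

/-- The control kernel is triangular, so off the diagonal one of the two linear terms vanishes; the
case x < s follows from s < x by symmetry. -/
theorem kernel_identity (hv : IsGoursatKernel Q M v) (hM : 0 ≤ M) (hQ : ContDiff ℝ 2 Q)
    (hQ0 : ∀ s, M ≤ s → Q s = 0) {x s : ℝ} (hx : 0 < x) (hs : 0 < s) (h : x ≠ s) :
    controlKernel v M s x + controlKernel v M x s +
      ∫ y, controlKernel v M y x * controlKernel v M y s ∂halfLine = responseKernel v M x s := by
  rw [hv.responseKernel_eq hM hQ0 hx.le hs.le]
  rcases lt_or_gt_of_ne h with hlt | hlt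
  · have h0 : controlKernel v M x s = 0 := if_neg fun h' => by linarith [h'.2.1]
    rw [h0, add_zero, add_comm x s, ← hv.kernel_identity_of_lt hM hQ hQ0 hx hlt]
    simp only [mul_comm]
  · have h0 : controlKernel v M s x = 0 := if_neg fun h' => by linarith [h'.2.1]
    rw [h0, zero_add, hv.kernel_identity_of_lt hM hQ hQ0 hs hlt]

theorem isReflectionKernel {a : ℝ} (hv : IsGoursatKernel Q (2 * a) v) (ha : 0 ≤ a)
    (hQc : Continuous Q) (hQ0 : ∀ s, 2 * a ≤ s → Q s = 0)
    (hsm : ∀ n : ℕ, ∃ V : ℝ × ℝ → ℝ, ContDiff ℝ n V ∧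
      ∀ ξ η, 0 ≤ ξ → 0 ≤ η → v (ξ, η) = V (ξ, η)) :
    IsReflectionKernel a (regularPart v) fun τ => v (2 * a, τ) := by
  have hM : 0 ≤ 2 * a := by linarith
  refine ⟨contDiffOn_infty.2 fun n => ?_, fun τ hτ => hv.eq_zero hQ0 hM hτ.le,
    fun x t hx h1 h2 => ?_⟩
  · obtain ⟨V, hV, hvV⟩ := hsm n
    exact (hV.comp (by fun_prop : ContDiff ℝ n fun τ : ℝ => (2 * a, τ))).contDiffOn.congr
      fun τ hτ => hvV _ _ hM hτ
  · rw [regularPart, if_neg (not_lt.2 h1)]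
    exact hv.eq_reflected hQc hQ0 hM (by linarith) (by linarith) (by linarith)

theorem isControlOperator (hv : IsGoursatKernel Q M v) (hQ0 : ∀ s, M ≤ s → Q s = 0) {B : ℝ}
    (hk : IsTruncatedKernel M B (controlKernel v M)) :
    IsControlOperator (regularPart v) (ContinuousLinearMap.id ℝ L2 + hk.operator) := by
  intro f hf
  filter_upwards [Lp.coeFn_add (hf.toLp f) (hk.operator (hf.toLp f)), hf.coeFn_toLp,
    hk.operator_apply (hf.toLp f), ae_restrict_mem measurableSet_Ioi] with x h1 h2 h3 hx
  have hx0 : 0 < x := hx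
  rw [add_apply, ContinuousLinearMap.id_apply, h1, Pi.add_apply, h2, h3, wave, add_zero,
    if_pos hx0.le]
  congr 1
  have e1 : ∫ s, controlKernel v M x s * hf.toLp f s ∂halfLine =
      ∫ s, controlKernel v M x s * f s ∂halfLine := by
    refine integral_congr_ae ?_
    filter_upwards [hf.coeFn_toLp] with s hs
    rw [hs]
  have e2 : ∫ s, controlKernel v M x s * f s ∂halfLine =
      ∫ s in Ioc 0 x, controlKernel v M x s * f s := by
    refine setIntegral_eq_of_subset_of_forall_sdiff_eq_zero measurableSet_Ioi
      Ioc_subset_Ioi_self fun s hs => ?_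
    rw [controlKernel, if_neg fun h' => hs.2 ⟨hs.1, h'.2.1⟩, zero_mul]
  rw [e1, e2, ← intervalIntegral.integral_of_le hx0.le]
  refine intervalIntegral.integral_congr fun s hs => ?_
  rw [uIcc_of_le hx0.le] at hs
  rw [hv.controlKernel_eq hQ0 hs.1 hs.2, regularPart, if_neg (by linarith [hs.2]), zero_sub,
    sub_neg_eq_add, ← sub_eq_add_neg]

theorem operator_responseKernel_apply (hv : IsGoursatKernel Q M v) (hM : 0 ≤ M)
    (hQ0 : ∀ s, M ≤ s → Q s = 0) {B : ℝ} (hr : IsTruncatedKernel M B (responseKernel v M))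
    (f : L2) : hr.operator f =ᵐ[halfLine] fun τ => ∫ s in Ioi (0 : ℝ), v (M, τ + s) * f s := by
  filter_upwards [hr.operator_apply f, ae_restrict_mem measurableSet_Ioi] with τ h1 hτ
  rw [h1]
  refine setIntegral_congr_fun measurableSet_Ioi fun s hs => ?_
  rw [hv.responseKernel_eq hM hQ0 (le_of_lt hτ) (le_of_lt hs)]

/-- Along (s, s − τ) the wave is f(2s − τ) plus the scattered part. The first term is why f must
vanish at infinity; the second is exactly constant once s ≥ M + τ, by the reflected form of the
kernel and its vanishing for η ≥ M. -/
theorem isResponseOperator (hv : IsGoursatKernel Q M v) (hM : 0 ≤ M) (hQc : Continuous Q)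
    (hQ0 : ∀ s, M ≤ s → Q s = 0) {B : ℝ} (hr : IsTruncatedKernel M B (responseKernel v M)) :
    IsResponseOperator (regularPart v) hr.operator := by
  intro f hf hf0
  filter_upwards [hv.operator_responseKernel_apply hM hQ0 hr (hf.toLp f),
    ae_restrict_mem measurableSet_Ioi] with τ h1 hτ
  have hτ0 : 0 < τ := hτ
  have e1 : ∫ s in Ioi (0 : ℝ), v (M, τ + s) * hf.toLp f s =
      ∫ s in Ioi (0 : ℝ), v (M, τ + s) * f s := by
    refine integral_congr_ae ?_
    filter_upwards [hf.coeFn_toLp] with s hs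
    rw [hs]
  rw [h1, e1]
  have h2 : Tendsto (fun s : ℝ => 2 * s - τ) atTop atTop :=
    tendsto_atTop_add_const_right _ (-τ) (tendsto_id.const_mul_atTop two_pos)
  have h3 := (hf0.comp h2).add_const (∫ s in Ioi (0 : ℝ), v (M, τ + s) * f s)
  rw [zero_add] at h3
  refine h3.congr' ?_
  filter_upwards [eventually_ge_atTop (M + τ)] with s hs
  have hpos : 0 ≤ s + (s - τ) := by linarith
  rw [wave, if_pos hpos, Function.comp_apply, show 2 * s - τ = s + (s - τ) by ring]
  congr 1
  rw [intervalIntegral.integral_of_le hpos]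
  have e2 : ∫ σ in Ioi (0 : ℝ), v (M, τ + σ) * f σ =
      ∫ σ in Ioc 0 (s + (s - τ)), v (M, τ + σ) * f σ := by
    refine setIntegral_eq_of_subset_of_forall_sdiff_eq_zero measurableSet_Ioi
      Ioc_subset_Ioi_self fun σ hσ => ?_
    have : s + (s - τ) < σ := by
      by_contra h'
      exact hσ.2 ⟨hσ.1, not_lt.1 h'⟩
    rw [hv.eq_zero hQ0 hM (by linarith), zero_mul]
  rw [e2]
  refine setIntegral_congr_fun measurableSet_Ioc fun σ hσ => ?_
  rw [regularPart, if_neg (by linarith [hσ.2]),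
    show s - (s - τ - σ) = τ + σ by ring, hv.eq_reflected hQc hQ0 hM (ξ := s + (s - τ - σ))
      (by linarith [hσ.2]) (by linarith [hσ.1]) (by linarith)]

end IsGoursatKernel

end Scattering

/-! ### Assembly -/

theorem theorem4 (q : ℝ → ℝ) (hq : ContDiffOn ℝ ∞ q (Ici 0))
    (a : ℝ) (ha : 0 ≤ a) (hqa : ∀ x, a < x → q x = 0) :
    ∃ (w : ℝ → ℝ → ℝ) (r : ℝ → ℝ) (W R : Scattering.L2 →L[ℝ] Scattering.L2),
      Scattering.IsFundamentalSolution q w ∧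
      (∀ f, Scattering.IsSmoothControl f →
        Scattering.IsClassicalSolution q f (Scattering.wave w f) ∧
        ∀ u, Scattering.IsClassicalSolution q f u →
          ∀ x t, 0 < x → t < x → u x t = Scattering.wave w f x t) ∧
      Scattering.IsReflectionKernel a w r ∧
      Scattering.IsControlOperator w W ∧
      Scattering.IsResponseOperator w R ∧
      (∀ f : Scattering.L2,
        R f =ᵐ[Scattering.halfLine] fun τ => ∫ s in Ioi (0 : ℝ), r (τ + s) * f s) ∧
      Scattering.connectingOperator W = ContinuousLinearMap.id ℝ Scattering.L2 + R := by
  open Scattering in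
  have hM : 0 ≤ 2 * a := by linarith
  have ext : ∀ n : ℕ, ∃ Q : ℝ → ℝ, ContDiff ℝ n Q ∧ (∀ s, 0 ≤ s → Q s = q (s / 2) / 4) := by
    intro n
    obtain ⟨g, hg, hgq⟩ := exists_contDiff_extension n hq
    exact ⟨fun s => g (s / 2) / 4, by fun_prop, fun s hs =>
      congrArg (· / 4) (hgq _ (by linarith))⟩
  -- Order 2 suffices for the equations and for the quadratic identity, which uses v_ηη.
  obtain ⟨Q, hQ, hQq⟩ := ext 2
  have hQc : Continuous Q := hQ.continuous
  have hQ0 : ∀ s, 2 * a ≤ s → Q s = 0 := by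
    -- The potential is assumed to vanish only strictly beyond a; continuity adds the endpoint s =
    -- 2a.
    have h1 : closure (Ioi (2 * a)) ⊆ {s | Q s = 0} :=
      (isClosed_eq hQc continuous_const).closure_subset_iff.2 fun s hs => by
        have : 2 * a < s := hs
        change Q s = 0
        rw [hQq s (by linarith), hqa _ (by linarith), zero_div]
    rw [closure_Ioi] at h1
    exact h1
  have hqQ : ∀ x, 0 < x → Q (x + x) = q x / 4 := fun x hx => by
    rw [hQq _ (by linarith), add_self_div_two]
  obtain ⟨v, hv⟩ := exists_isGoursatKernel hQc (2 * a)
  have hsm : ∀ n : ℕ, ∃ V : ℝ × ℝ → ℝ, ContDiff ℝ n V ∧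
      ∀ ξ η, 0 ≤ ξ → 0 ≤ η → v (ξ, η) = V (ξ, η) := by
    intro n
    obtain ⟨Q', hQ', hQq'⟩ := ext n
    obtain ⟨V, hV⟩ := exists_isGoursatKernel hQ'.continuous (2 * a)
    exact ⟨V, hV.contDiff hQ', fun ξ η hξ hη => hv.eq_of_eqOn hV hM hQc
      (fun s hs => by rw [hQq s hs, hQq' s hs]) hξ hη⟩
  obtain ⟨B, hk⟩ := exists_isTruncatedKernel_controlKernel hv.continuous (2 * a)
  obtain ⟨B', hr⟩ := exists_isTruncatedKernel_responseKernel hv.continuous (2 * a)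
  exact ⟨regularPart v, fun τ => v (2 * a, τ), ContinuousLinearMap.id ℝ L2 + hk.operator,
    hr.operator, isFundamentalSolution_regularPart hv hQ hQ0 hqQ,
    fun f hf => ⟨isClassicalSolution_wave hv hQ hQ0 hqQ hsm hf, fun u hu x t hx ht =>
      hu.unique hM hQc hQ0 hqQ (isClassicalSolution_wave hv hQ hQ0 hqQ hsm hf) hx ht⟩,
    hv.isReflectionKernel ha hQc hQ0 hsm, hv.isControlOperator hQ0 hk,
    hv.isResponseOperator hM hQc hQ0 hr, hv.operator_responseKernel_apply hM hQ0 hr,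
    connectingOperator_eq hk hr fun x s hx hs h => hv.kernel_identity hM hQ hQ0 hx hs h⟩
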